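/- Let $M^{\mathrm{out}}$ be a smooth Riemannian manifold of dimension $m+1$ with metric $g^{\mathrm{out}}$ and let $f:M\to M^{\mathrm{out}}$ be an immersed smooth hypersurface, $\dim M=m$ (for example a submanifold $M\subset M^{\mathrm{out}}$), with induced metric $g=f^*g^{\mathrm{out}}$; identify $T_pM$ with $df(T_pM)\subset T_{f(p)}M^{\mathrm{out}}$. Let $\nabla^{\mathrm{out}}$, $\nabla$ be the Levi-Civita connections and $R^{\mathrm{out}}$, $R$ the curvature tensors of $g^{\mathrm{out}}$ and $g$, with $R_{X,Y}=\nabla_X\nabla_Y-\nabla_Y\nabla_X-\nabla_{[X,Y]}$. Given a (local) unit normal field $N$ of $M$, define the second fundamental form by $\nabla^{\mathrm{out}}_XY=\nabla_XY+\mathrm{II}(X,Y)N$ for vector fields $X,Y$ on $M$, and the shape operator $\mathrm{II}:TM\to TM$ by $g(\mathrm{II}_X,Y)=\mathrm{II}(X,Y)$; replacing $N$ by $-N$ changes $\mathrm{II}$ only by a sign. The intermediate curvature is $R^{\mathrm{inter}}_{X,Y}Z=\mathrm{pr}^\perp_{TM}(R^{\mathrm{out}}_{X,Y}Z)$ for $X,Y,Z\in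 T_pM$, where $\mathrm{pr}^\perp_{TM}$ is the orthogonal projection onto $TM$. The Ricci endomorphism $\mathrm{Ric}$ and the intermediate Ricci endomorphism $\mathrm{Ric}^{\mathrm{inter}}$ of $TM$ are defined by $$g(\mathrm{Ric}\,X,Y)=\mathrm{tr}_{TM}(Z\mapsto R_{Z,X}Y),\qquad g(\mathrm{Ric}^{\mathrm{inter}}X,Y)=\mathrm{tr}_{TM}(Z\mapsto R^{\mathrm{inter}}_{Z,X}Y).$$ The hypersurface $M$ is called permeable if $$R_{X,Y}\,\mathrm{II}_Z+R_{Y,Z}\,\mathrm{II}_X+R_{Z,X}\,\mathrm{II}_Y=0\qquad\text{for all }p\in M,\ X,Y,Z\in T_pM .$$ Then the following hold. 1. If $M$ is permeable, then $[\mathrm{Ric},\mathrm{II}]=0$ and $[\mathrm{Ric}^{\mathrm{inter}},\mathrm{II}]=0$ on $M$. 2. Suppose that $m=3$ (a $3$-dimensional hypersurface in a $4$-dimensional manifold), or that $M^{\mathrm{out}}$ is conformally flat, i.e. every point of $M^{\mathrm{out}}$ has an open neighbourhood $U$ with a smooth function $\varphi:U\to\mathbb{R}$ such that the metric $e^{2\varphi}g^{\mathrm{out}}$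 on $U$ has vanishing curvature tensor. If $[\mathrm{Ric}^{\mathrm{inter}},\mathrm{II}]=0$ on $M$, then $M$ is permeable. 3. In particular, if all sectional curvatures of $M^{\mathrm{out}}$ are equal to one constant $c\in\mathbb{R}$ (as in every space form), then $M$ is permeable. -/

import Mathlib

open Bundle Filter Topology Manifold
open scoped ContDiff

set_option maxSynthPendingDepth 3

noncomputable section

namespace Hypersurface

/-! ## Multilinear algebra on a single tangent space -/

section Algebra

variable {V W : Type*} [NormedAddCommGroup V] [NormedSpace ℝ V]
  [NormedAddCommGroup W] [NormedSpace ℝ W]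

/-- The linear form `w ↦ B(v, w)` is `B v`; for a nondegenerate bilinear form `B` on a
finite-dimensional space, `sharp B` is the inverse isomorphism, which sends a linear form `α` to the
vector `v` with `B(v, w) = α(w)` for all `w`. -/
def sharp (B : V →L[ℝ] V →L[ℝ] ℝ) : (V →L[ℝ] ℝ) →L[ℝ] V := B.inverse

/-- The endomorphism `A` associated to a bilinear form `b` by means of the scalar product `B`, that
is `B(A X, Y) = b(X, Y)`. -/
def endOfForm (B b : V →L[ℝ] V →L[ℝ] ℝ) : V →L[ℝ] V := (sharp B).comp b

/-- Interchanging the two arguments of a bilinear map, as a continuous linear operation. -/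
def swapCLM (V W : Type*) [NormedAddCommGroup V] [NormedSpace ℝ V] [NormedAddCommGroup W]
    [NormedSpace ℝ W] : (V →L[ℝ] V →L[ℝ] W) →L[ℝ] V →L[ℝ] V →L[ℝ] W :=
  (ContinuousLinearMap.flipₗᵢ ℝ V V W).toContinuousLinearEquiv.toContinuousLinearMap

theorem swapCLM_apply (b : V →L[ℝ] V →L[ℝ] W) (v w : V) : swapCLM V W b v w = b w v := rfl

/-- Three-linear maps `(X, Y, Z) ↦ R_{X,Y} Z`. -/
abbrev Curv (V : Type*) [NormedAddCommGroup V] [NormedSpace ℝ V] : Type _ :=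
  V →L[ℝ] V →L[ℝ] V →L[ℝ] V

/-- The trace of endomorphisms, as a continuous linear form. -/
def trCLM (V : Type*) [NormedAddCommGroup V] [NormedSpace ℝ V] [FiniteDimensional ℝ V] :
    (V →L[ℝ] V) →L[ℝ] ℝ :=
  LinearMap.toContinuousLinearMap (LinearMap.trace ℝ V ∘ₗ ContinuousLinearMap.coeLM ℝ)

/-- The Ricci form `Ric(X, Y) = tr (Z ↦ R_{Z,X} Y)`, see `ricciForm_apply`. -/
def ricciForm [FiniteDimensional ℝ V] (R : Curv V) : V →L[ℝ] V →L[ℝ] ℝ :=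
  (ContinuousLinearMap.compL ℝ V (V →L[ℝ] V) ℝ (trCLM V)).comp
    ((swapCLM V V).comp R.flip)

theorem ricciForm_apply [FiniteDimensional ℝ V] (R : Curv V) (X Y : V) :
    ricciForm R X Y = LinearMap.trace ℝ V
      { toFun := fun Z => R Z X Y
        map_add' := fun a b => by simp
        map_smul' := fun c a => by simp } := rfl

/-- The Ricci endomorphism, `B(Ric X, Y) = Ric(X, Y)`. -/
def ricciEnd [FiniteDimensional ℝ V] (B : V →L[ℝ] V →L[ℝ] ℝ) (R : Curv V) : V →L[ℝ] V :=
  endOfForm B (ricciForm R)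

end Algebra

/-! ## Metrics on an open subset of a vector space -/

section Local

variable {V : Type*} [NormedAddCommGroup V] [NormedSpace ℝ V]

/-- The Christoffel symbols of the first kind of a metric `G` given in a chart:
`Γ₁(v, w)(z) = ½ (∂_v G(w, z) + ∂_w G(v, z) - ∂_z G(v, w))`, see `christoffelFirst_apply`. -/
def christoffelFirst (G : V → V →L[ℝ] V →L[ℝ] ℝ) (x : V) : V →L[ℝ] V →L[ℝ] V →L[ℝ] ℝ :=
  (1 / 2 : ℝ) • (fderiv ℝ G x + (fderiv ℝ G x).flip
    - (swapCLM V ℝ).comp (fderiv ℝ G x).flip)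

theorem christoffelFirst_apply (G : V → V →L[ℝ] V →L[ℝ] ℝ) (x v w z : V) :
    christoffelFirst G x v w z =
      (1 / 2 : ℝ) * (fderiv ℝ G x v w z + fderiv ℝ G x w v z - fderiv ℝ G x z v w) := rfl

/-- The Christoffel symbols `Γ(v, w) = (∇_v w)(x)` of the Levi-Civita connection of `G` for constant
vector fields `v, w`. -/
def christoffel (G : V → V →L[ℝ] V →L[ℝ] ℝ) (x : V) : V →L[ℝ] V →L[ℝ] V :=
  (ContinuousLinearMap.compL ℝ V (V →L[ℝ] ℝ) V (sharp (G x))).comp (christoffelFirst G x)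

theorem christoffel_apply (G : V → V →L[ℝ] V →L[ℝ] ℝ) (x v w : V) :
    christoffel G x v w = sharp (G x) (christoffelFirst G x v w) := rfl

/-- The covariant derivative `∇_u (∇_v w)` at `x` of constant vector fields. -/
def secondCovariant (G : V → V →L[ℝ] V →L[ℝ] ℝ) (x : V) : Curv V :=
  fderiv ℝ (christoffel G) x
    + (ContinuousLinearMap.compL ℝ V V V).bilinearComp (christoffel G x) (christoffel G x)

theorem secondCovariant_apply (G : V → V →L[ℝ] V →L[ℝ] ℝ) (x u v w : V) :
    secondCovariant G x u v w =
      fderiv ℝ (christoffel G) x u v w + christoffel G x u (christoffel G x v w) := rfl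

/-- The curvature tensor `R_{u,v} w = ∇_u ∇_v w - ∇_v ∇_u w` of the Levi-Civita connection of `G`,
for constant (hence commuting) vector fields `u, v, w`. -/
def localCurvature (G : V → V →L[ℝ] V →L[ℝ] ℝ) (x : V) : Curv V :=
  secondCovariant G x - (secondCovariant G x).flip

theorem localCurvature_apply (G : V → V →L[ℝ] V →L[ℝ] ℝ) (x u v w : V) :
    localCurvature G x u v w = secondCovariant G x u v w - secondCovariant G x v u w := rfl

end Local

/-! ## Riemannian geometry of manifolds

A manifold of dimension `n` is modelled on `E n`. In Mathlib the tangent space `TangentSpace (𝓡 n) p`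
is by definition the vector space `E n`, via the preferred chart `extChartAt (𝓡 n) p` at `p`, and
derivatives `mfderiv` are computed in the preferred charts. -/

section Manifold

/-- The model space. -/
abbrev E (n : ℕ) : Type := EuclideanSpace ℝ (Fin n)

variable {n k : ℕ}
  {M : Type*} [TopologicalSpace M] [ChartedSpace (E n) M]
  {N : Type*} [TopologicalSpace N] [ChartedSpace (E k) N]

/-- A family of bilinear forms on the tangent spaces of `M`. -/
abbrev FormField (n : ℕ) (M : Type*) [TopologicalSpace M] [ChartedSpace (E n) M] : Type _ :=
  (p : M) → (TangentSpace (𝓡 n) p →L[ℝ] TangentSpace (𝓡 n) p →L[ℝ] ℝ)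

/-- The value of a family of bilinear forms at `p`, on the vector space `E n` underlying the tangent
space. -/
def FormField.at (g : FormField n M) (p : M) : E n →L[ℝ] E n →L[ℝ] ℝ := g p

/-- The derivative of `f` at `p` as a linear map between the vector spaces underlying the tangent
spaces. -/
def differential (f : M → N) (p : M) : E n →L[ℝ] E k := mfderiv (𝓡 n) (𝓡 k) f p

/-- The pullback `(f^*g)_p(X, Y) = g_{f(p)}(df X, df Y)`. -/
def pullback (f : M → N) (g : FormField k N) : FormField n M := fun p =>
  ((g.at (f p)).bilinearComp (differential f p) (differential f p) : E n →L[ℝ] E n →L[ℝ] ℝ)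

/-- The coordinate expression of `g` in the preferred chart at `p`. -/
def inChart (g : FormField n M) (p : M) : E n → E n →L[ℝ] E n →L[ℝ] ℝ := fun x =>
  FormField.at (pullback (extChartAt (𝓡 n) p).symm g) x

/-- The Christoffel symbols at `p` of `g` in the preferred chart at `p`. -/
def christoffelAt (g : FormField n M) (p : M) : E n →L[ℝ] E n →L[ℝ] E n :=
  christoffel (inChart g p) (extChartAt (𝓡 n) p p)

/-- The Riemann curvature tensor of `g` at `p`, a tensor on the tangent space at `p`. It is computed
in the preferred chart at `p`, the one which identifies the tangent space at `p` with `E n`. -/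
def curvature (g : FormField n M) (p : M) : Curv (E n) :=
  localCurvature (inChart g p) (extChartAt (𝓡 n) p p)

/-- The sectional curvature of the plane spanned by `X` and `Y`. -/
def sectionalCurvature (g : FormField n M) (p : M) (X Y : E n) : ℝ :=
  g.at p (curvature g p X Y Y) X / (g.at p X X * g.at p Y Y - g.at p X Y ^ 2)

/-- All sectional curvatures of `g` are equal to `c`. -/
def HasConstantCurvature (g : FormField n M) (c : ℝ) : Prop :=
  ∀ (p : M) (X Y : E n), LinearIndependent ℝ ![X, Y] → sectionalCurvature g p X Y = c

/-- `(M, g)` is conformally flat: every point has an open neighbourhood `U` with a smooth function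
`φ` on `U` such that the metric `e^{2φ} g` on `U` is flat. -/
def IsConformallyFlat (g : FormField n M) : Prop :=
  ∀ q : M, ∃ U : Set M, IsOpen U ∧ q ∈ U ∧ ∃ φ : M → ℝ,
    ContMDiffOn (𝓡 n) 𝓘(ℝ, ℝ) ∞ φ U ∧
      ∀ p ∈ U, curvature (fun y : M => Real.exp (2 * φ y) • g y) p = 0

end Manifold

section Immersed

/-! ## Hypersurfaces

`f : M → N` is a map from a manifold of dimension `n` to a manifold of dimension `n + 1`, and `g` is
the metric of `N` (the outer metric). -/

variable (n : ℕ)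
  {M : Type*} [TopologicalSpace M] [ChartedSpace (E n) M]
  {N : Type*} [TopologicalSpace N] [ChartedSpace (E (n + 1)) N]

/-- `f : M → N` is a smooth immersion. -/
structure IsSmoothImmersion (f : M → N) : Prop where
  contMDiff : ContMDiff (𝓡 n) (𝓡 (n + 1)) ∞ f
  injective_mfderiv : ∀ p : M, Function.Injective (mfderiv (𝓡 n) (𝓡 (n + 1)) f p)

/-- The Riemannian curvature tensor `R` of `M` with the induced metric. -/
def innerCurvature (f : M → N) (g : FormField (n + 1) N) (p : M) : Curv (E n) :=
  curvature (pullback f g) p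

/-- The orthogonal projection of the tangent space of `N` at `f p` to the tangent space of `M` at
`p`: the vector `tangentialProjection n f g p W` is the vector `X` with
`(f^*g)(X, Y) = g(W, df Y)` for all `Y`. -/
def tangentialProjection (f : M → N) (g : FormField (n + 1) N) (p : M) : E (n + 1) →L[ℝ] E n :=
  (sharp ((pullback f g).at p)).comp
    (((ContinuousLinearMap.compL ℝ (E n) (E (n + 1)) ℝ).flip (differential f p)).comp (g.at (f p)))

theorem tangentialProjection_apply (f : M → N) (g : FormField (n + 1) N) (p : M) (W : E (n + 1)) :
    tangentialProjection n f g p W =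
      sharp ((pullback f g).at p) ((g.at (f p) W).comp (differential f p)) := rfl

/-- The intermediate curvature: `R^inter_{X,Y} Z` is the tangential projection of
`R^out_{df X, df Y} (df Z)`, see `intermediateCurvature_apply`. -/
def intermediateCurvature (f : M → N) (g : FormField (n + 1) N) (p : M) : Curv (E n) :=
  (ContinuousLinearMap.compL ℝ (E n) (E (n + 1) →L[ℝ] E (n + 1)) (E n →L[ℝ] E n)
    ((ContinuousLinearMap.compL ℝ (E n) (E (n + 1)) (E n) (tangentialProjection n f g p)).comp
      ((ContinuousLinearMap.compL ℝ (E n) (E (n + 1)) (E (n + 1))).flip (differential f p)))).comp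
    ((curvature g (f p)).bilinearComp (differential f p) (differential f p))

theorem intermediateCurvature_apply (f : M → N) (g : FormField (n + 1) N) (p : M) (X Y Z : E n) :
    intermediateCurvature n f g p X Y Z =
      tangentialProjection n f g p
        (curvature g (f p) (differential f p X) (differential f p Y) (differential f p Z)) := rfl

/-- The Ricci endomorphism of `M` with the induced metric. -/
def innerRicci (f : M → N) (g : FormField (n + 1) N) (p : M) : E n →L[ℝ] E n :=
  ricciEnd ((pullback f g).at p) (innerCurvature n f g p)

/-- The intermediate Ricci endomorphism. -/
def intermediateRicci (f : M → N) (g : FormField (n + 1) N) (p : M) : E n →L[ℝ] E n :=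
  ricciEnd ((pullback f g).at p) (intermediateCurvature n f g p)

/-- The difference `(X, Y) ↦ ∇^out_X (df Y) - df (∇_X Y)` at `p`, a vector tangent to `N` at `f p`.
For the constant vector fields `X, Y` in the preferred chart at `p`, with `F` the coordinate
expression of `f`, it reads
`D²F(X, Y) + Γ^out(DF X, DF Y) - DF (Γ(X, Y))`, see `hessian_apply`. -/
def hessian (f : M → N) (g : FormField (n + 1) N) (p : M) : E n →L[ℝ] E n →L[ℝ] E (n + 1) :=
  fderiv ℝ (fderiv ℝ (writtenInExtChartAt (𝓡 n) (𝓡 (n + 1)) p f)) (extChartAt (𝓡 n) p p)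
    + (christoffelAt g (f p)).bilinearComp (differential f p) (differential f p)
    - (ContinuousLinearMap.compL ℝ (E n) (E n) (E (n + 1)) (differential f p)).comp
        (christoffelAt (pullback f g) p)

theorem hessian_apply (f : M → N) (g : FormField (n + 1) N) (p : M) (X Y : E n) :
    hessian n f g p X Y =
      fderiv ℝ (fderiv ℝ (writtenInExtChartAt (𝓡 n) (𝓡 (n + 1)) p f)) (extChartAt (𝓡 n) p p) X Y
        + christoffelAt g (f p) (differential f p X) (differential f p Y)
        - differential f p (christoffelAt (pullback f g) p X Y) := rfl

/-- `ν` is a unit normal vector of the hypersurface at `p`. -/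
def IsUnitNormal (f : M → N) (g : FormField (n + 1) N) (p : M) (ν : E (n + 1)) : Prop :=
  g.at (f p) ν ν = 1 ∧ ∀ X : E n, g.at (f p) ν (differential f p X) = 0

/-- The second fundamental form at `p` with respect to the unit normal vector `ν`; it is defined by
`∇^out_X Y = ∇_X Y + II(X, Y) ν`, that is `II(X, Y) = g(ν, ∇^out_X Y - ∇_X Y)`. -/
def secondFundamentalForm (f : M → N) (g : FormField (n + 1) N) (p : M) (ν : E (n + 1)) :
    E n →L[ℝ] E n →L[ℝ] ℝ :=
  (ContinuousLinearMap.compL ℝ (E n) (E (n + 1)) ℝ (g.at (f p) ν)).comp (hessian n f g p)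

theorem secondFundamentalForm_apply (f : M → N) (g : FormField (n + 1) N) (p : M) (ν : E (n + 1))
    (X Y : E n) :
    secondFundamentalForm n f g p ν X Y = g.at (f p) ν (hessian n f g p X Y) := rfl

/-- The shape operator `II`, `(f^*g)(II X, Y) = II(X, Y)`. -/
def shapeOperator (f : M → N) (g : FormField (n + 1) N) (p : M) (ν : E (n + 1)) : E n →L[ℝ] E n :=
  endOfForm ((pullback f g).at p) (secondFundamentalForm n f g p ν)

/-- The hypersurface is permeable: the vector-valued `3`-form
`R_{X,Y} II_Z + R_{Y,Z} II_X + R_{Z,X} II_Y` vanishes at every point, where `II` is formed with a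
unit normal vector `ν` at the point (`ν` and `-ν` give the same condition). -/
def IsPermeable (f : M → N) (g : FormField (n + 1) N) : Prop :=
  ∀ (p : M) (ν : E (n + 1)), IsUnitNormal n f g p ν → ∀ X Y Z : E n,
    innerCurvature n f g p X Y (shapeOperator n f g p ν Z)
      + innerCurvature n f g p Y Z (shapeOperator n f g p ν X)
      + innerCurvature n f g p Z X (shapeOperator n f g p ν Y) = 0

end Immersed

end Hypersurface

end

/-!
Let `A` be the shape operator of the hypersurface. By the Gauss equation `R - R^inter` is the wedge
of `II` with `A`, which drops out of `R_{X,Y} A Z + R_{Y,Z} A X + R_{Z,X} A Y` because `II(Y, A Z)`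
is symmetric in `Y` and `Z`; hence permeability may be tested with `R^inter` instead of `R`. For any
curvature tensor `S`, the form `S_{X,Y} A Z + S_{Y,Z} A X + S_{Z,X} A Y` is a vector-valued 3-form
whose trace over `X` is, paired with the metric, the commutator of `A` with the Ricci endomorphism
of `S`. If the form vanishes, so does the commutator, and in dimension three a vector-valued 3-form
with vanishing trace is zero.

If the ambient manifold is conformally flat, then `R^inter` is the Kulkarni–Nomizu product of the
metric with a symmetric endomorphism `T`, so the form vanishes as soon as `T` commutes with `A`. The
Ricci endomorphism is `tr T + (m - 2) T`, hence commuting with it amounts to commuting with `T`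
unless `m = 2`, where there are no nonzero 3-forms. Constant curvature `c` is the case `T = c / 2`.
-/

namespace Hypersurface

section ScalarProduct

variable {V : Type*} [NormedAddCommGroup V] [NormedSpace ℝ V] {B : V →L[ℝ] V →L[ℝ] ℝ}

/-- Symmetric nondegenerate bilinear forms; nondegeneracy is stated as invertibility of
`v ↦ B(v, ·)`, so that `sharp B` is a genuine inverse. -/
structure IsScalarProduct (B : V →L[ℝ] V →L[ℝ] ℝ) : Prop where
  symm : ∀ v w, B v w = B w v
  isInvertible : B.IsInvertible

theorem isInvertible_of_pos [FiniteDimensional ℝ V] (hB : ∀ v, v ≠ 0 → 0 < B v v) :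
    B.IsInvertible := by
  have injective : Function.Injective (B : V →ₗ[ℝ] V →L[ℝ] ℝ) := by
    refine (injective_iff_map_eq_zero _).mpr fun v hv => ?_
    have hBv : B v = 0 := hv
    by_contra hne
    exact (hB v hne).ne' (by rw [hBv, zero_apply])
  have finrank_eq : Module.finrank ℝ V = Module.finrank ℝ (V →L[ℝ] ℝ) :=
    Subspace.dual_finrank_eq.symm.trans LinearMap.toContinuousLinearMap.finrank_eq
  exact ⟨(LinearMap.linearEquivOfInjective _ injective finrank_eq).toContinuousLinearEquiv, rfl⟩

theorem apply_sharp (hB : B.IsInvertible) (α : V →L[ℝ] ℝ) (w : V) : B (sharp B α) w = α w :=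
  congrArg (fun β : V →L[ℝ] ℝ => β w) (hB.self_apply_inverse α)

theorem apply_endOfForm (hB : B.IsInvertible) (b : V →L[ℝ] V →L[ℝ] ℝ) (v w : V) :
    B (endOfForm B b v) w = b v w :=
  apply_sharp hB (b v) w

theorem ext_of_form (hB : B.IsInvertible) {v v' : V} (h : ∀ w, B v w = B v' w) : v = v' :=
  hB.injective (ContinuousLinearMap.ext h)

theorem sq_lt_mul_of_linearIndependent (hsymm : ∀ v w, B v w = B w v)
    (hpos : ∀ v, v ≠ 0 → 0 < B v v) {v w : V} (h : LinearIndependent ℝ ![v, w]) :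
    B v w ^ 2 < B v v * B w w :=
  (LinearMap.BilinForm.apply_sq_lt_iff_linearIndependent_of_symm
    ((ContinuousLinearMap.coeLM ℝ).comp (B : V →ₗ[ℝ] V →L[ℝ] ℝ)) hpos ⟨hsymm⟩ v w).mpr h

theorem eq_smul_of_orthogonal_range {W : Type*} [NormedAddCommGroup W] [NormedSpace ℝ W]
    [FiniteDimensional ℝ V] [FiniteDimensional ℝ W] (hB : IsScalarProduct B) {L : W →L[ℝ] V}
    (hL : Function.Injective L) (hdim : Module.finrank ℝ V = Module.finrank ℝ W + 1) {ν v : V}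
    (hν : B ν ν = 1) (hνL : ∀ w, B ν (L w) = 0) (hvL : ∀ w, B v (L w) = 0) : v = B ν v • ν := by
  let Φ : W × ℝ →ₗ[ℝ] V := (L : W →ₗ[ℝ] V).coprod (LinearMap.toSpanSingleton ℝ V ν)
  have Φ_apply (w : W) (t : ℝ) : Φ (w, t) = L w + t • ν := rfl
  have injective : Function.Injective Φ := by
    refine (injective_iff_map_eq_zero Φ).mpr fun ⟨w, t⟩ h => ?_
    rw [Φ_apply] at h
    have t_eq_zero : t = 0 := by
      simpa only [map_add, map_smul, hνL, hν, smul_eq_mul, mul_one, zero_add, map_zero] using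
        congrArg (B ν) h
    rw [t_eq_zero, zero_smul, add_zero] at h
    rw [t_eq_zero, (injective_iff_map_eq_zero L).mp hL w h, Prod.mk_zero_zero]
  have surjective : Function.Surjective Φ :=
    (LinearMap.injective_iff_surjective_of_finrank_eq_finrank (by simp [hdim])).mp injective
  refine ext_of_form hB.isInvertible fun w => ?_
  obtain ⟨⟨w, t⟩, rfl⟩ := surjective w
  simp only [Φ_apply, map_add, map_smul, smul_apply, smul_eq_mul, hvL, hνL, hν, hB.symm v ν]
  ring

end ScalarProduct

section Trace

variable {V : Type*} [NormedAddCommGroup V] [NormedSpace ℝ V] [FiniteDimensional ℝ V]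

theorem trCLM_smulRight (α : V →L[ℝ] ℝ) (v : V) : trCLM V (α.smulRight v) = α v :=
  LinearMap.trace_smulRight (α : V →ₗ[ℝ] ℝ) v

theorem trCLM_id : trCLM V (ContinuousLinearMap.id ℝ V) = Module.finrank ℝ V :=
  LinearMap.trace_id ℝ V

theorem trCLM_comp_comm (L L' : V →L[ℝ] V) : trCLM V (L.comp L') = trCLM V (L'.comp L) :=
  LinearMap.trace_comp_comm' (L' : V →ₗ[ℝ] V) (L : V →ₗ[ℝ] V)

theorem trCLM_eq_of_adjoint {B : V →L[ℝ] V →L[ℝ] ℝ} (hB : B.IsInvertible) {L L' : V →L[ℝ] V}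
    (h : ∀ x y, B (L x) y = B x (L' y)) : trCLM V L = trCLM V L' := by
  obtain ⟨e, rfl⟩ := hB
  let toDual : V ≃ₗ[ℝ] Module.Dual ℝ V :=
    e.toLinearEquiv.trans LinearMap.toContinuousLinearMap.symm
  have conj_eq_transpose :
      toDual.conj (L : V →ₗ[ℝ] V) = Module.Dual.transpose (R := ℝ) (L' : V →ₗ[ℝ] V) := by
    ext φ y
    obtain ⟨x, rfl⟩ := toDual.surjective φ
    rw [LinearEquiv.conj_apply_apply, toDual.symm_apply_apply]
    exact h x y
  calc trCLM V L = LinearMap.trace ℝ _ (toDual.conj (L : V →ₗ[ℝ] V)) :=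
        (LinearMap.trace_conj' (L : V →ₗ[ℝ] V) toDual).symm
    _ = trCLM V L' := by rw [conj_eq_transpose, LinearMap.trace_transpose']; rfl

theorem ricciForm_eq_trCLM (R : Curv V) (X Y : V) :
    ricciForm R X Y = trCLM V ((R.flip X).flip Y) := rfl

end Trace

section AlternatingTrace

variable {K V ι : Type*} [CommRing K] [AddCommGroup V] [Module K V] [Finite ι] [DecidableEq ι]

theorem trace_alternating_toLinearMap_basis (e : Module.Basis ι K V) (P : V [⋀^ι]→ₗ[K] V) (i : ι) :
    LinearMap.trace K V (P.toMultilinearMap.toLinearMap e i) = e.coord i (P e) := by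
  have eq_smulRight : P.toMultilinearMap.toLinearMap e i = (e.coord i).smulRight (P e) := by
    refine e.ext fun j => ?_
    obtain rfl | hij := eq_or_ne j i
    · simp [MultilinearMap.toLinearMap_apply]
    · simp [MultilinearMap.toLinearMap_apply, P.map_update_self e hij.symm, hij]
  have := Module.Free.of_basis e
  have := Module.Finite.of_basis e
  rw [eq_smulRight, LinearMap.trace_smulRight]

theorem alternating_eq_zero_of_trace_eq_zero (e : Module.Basis ι K V) (P : V [⋀^ι]→ₗ[K] V)
    (h : ∀ i, LinearMap.trace K V (P.toMultilinearMap.toLinearMap e i) = 0) : P = 0 := by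
  have apply_basis : P e = 0 := e.ext_elem fun i => by
    rw [map_zero, Finsupp.zero_apply]
    exact (trace_alternating_toLinearMap_basis e P i).symm.trans (h i)
  refine e.ext_alternating fun σ hσ => ?_
  have := Fintype.ofFinite ι
  exact (P.map_perm e (Equiv.ofBijective σ hσ.bijective_of_finite)).trans (by simp [apply_basis])

end AlternatingTrace

section CyclicSum

variable {V : Type*} [NormedAddCommGroup V] [NormedSpace ℝ V]

/-- The sum of `S_{X,Y} Z` over the cyclic permutations of `X, Y, Z`, see `cyclicSum_apply`. -/
noncomputable def cyclicSum (S : Curv V) : Curv V :=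
  S + ((swapCLM V V).comp S).flip + (swapCLM V V).comp S.flip

theorem cyclicSum_apply (S : Curv V) (X Y Z : V) :
    cyclicSum S X Y Z = S X Y Z + S Y Z X + S Z X Y := rfl

theorem cyclicSum_rotate (S : Curv V) (X Y Z : V) : cyclicSum S X Y Z = cyclicSum S Y Z X := by
  simp only [cyclicSum_apply]
  abel

theorem cyclicSum_self_left {S : Curv V} (hS : ∀ X Y Z, S X Y Z = -S Y X Z) (X Z : V) :
    cyclicSum S X X Z = 0 := by
  have : IsAddTorsionFree V := .of_isTorsionFree ℝ V
  rw [cyclicSum_apply, self_eq_neg.mp (hS X X Z), hS Z X]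
  abel

/-- The cyclic sum of a map which is skew in its first two arguments, as an alternating map. -/
noncomputable def cyclicSumAlternating (S : Curv V) (hS : ∀ X Y Z, S X Y Z = -S Y X Z) :
    V [⋀^Fin 3]→ₗ[ℝ] V where
  toMultilinearMap := .mk' (fun v => cyclicSum S (v 0) (v 1) (v 2))
    (fun v i x y => by fin_cases i <;> simp) (fun v i c x => by fin_cases i <;> simp)
  map_eq_zero_of_eq' v i j hv hij := by
    have zero_of_eq (X Y Z : V) (h : X = Y ∨ Y = Z ∨ Z = X) : cyclicSum S X Y Z = 0 := by
      obtain rfl | rfl | rfl := h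
      · exact cyclicSum_self_left hS X Z
      · rw [cyclicSum_rotate, cyclicSum_self_left hS]
      · rw [cyclicSum_rotate, cyclicSum_rotate, cyclicSum_self_left hS]
    exact zero_of_eq _ _ _ (by fin_cases i <;> fin_cases j <;> simp_all)

theorem cyclicSum_eq_zero_of_finrank_lt [FiniteDimensional ℝ V] {S : Curv V}
    (hS : ∀ X Y Z, S X Y Z = -S Y X Z) (hV : Module.finrank ℝ V < 3) : cyclicSum S = 0 := by
  ext X Y Z
  refine (cyclicSumAlternating S hS).map_linearDependent ![X, Y, Z] fun h => ?_
  exact hV.not_ge (by simpa using h.fintype_card_le_finrank)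

theorem cyclicSum_eq_zero_of_trCLM_eq_zero [FiniteDimensional ℝ V] {S : Curv V}
    (hS : ∀ X Y Z, S X Y Z = -S Y X Z) (hV : Module.finrank ℝ V = 3)
    (h : ∀ Y Z, trCLM V (cyclicSum S Y Z) = 0) : cyclicSum S = 0 := by
  let e : Module.Basis (Fin 3) ℝ V := Module.finBasisOfFinrankEq ℝ V hV
  have rotate (i : Fin 3) : (cyclicSumAlternating S hS).toMultilinearMap.toLinearMap e i
      = cyclicSum S (e (i + 1)) (e (i + 2)) := by
    ext X
    fin_cases i
    · exact cyclicSum_rotate S X (e 1) (e 2)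
    · exact (cyclicSum_rotate S (e 2) (e 0) X).symm
    · rfl
  have alternating_eq_zero : cyclicSumAlternating S hS = 0 :=
    alternating_eq_zero_of_trace_eq_zero e _ fun i => by rw [rotate]; exact h _ _
  ext X Y Z
  exact congrArg (fun P : V [⋀^Fin 3]→ₗ[ℝ] V => P ![X, Y, Z]) alternating_eq_zero

end CyclicSum

section CurvatureTensor

variable {V : Type*} [NormedAddCommGroup V] [NormedSpace ℝ V] {B : V →L[ℝ] V →L[ℝ] ℝ}
  {R R' : Curv V}

/-- The algebraic symmetries of a Riemannian curvature tensor. The pair symmetry follows from the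
others, see `IsCurvatureTensor.pair_symm`. -/
structure IsCurvatureTensor (B : V →L[ℝ] V →L[ℝ] ℝ) (R : Curv V) : Prop where
  antisymm : ∀ X Y Z, R X Y Z = -R Y X Z
  skew : ∀ X Y Z W, B (R X Y Z) W = -B (R X Y W) Z
  bianchi : cyclicSum R = 0

namespace IsCurvatureTensor

theorem form_antisymm (hR : IsCurvatureTensor B R) (X Y Z W : V) :
    B (R X Y Z) W = -B (R Y X Z) W := by
  rw [hR.antisymm, map_neg, neg_apply]

theorem form_bianchi (hR : IsCurvatureTensor B R) (X Y Z W : V) :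
    B (R X Y Z) W + B (R Y Z X) W + B (R Z X Y) W = 0 := by
  have bianchi : R X Y Z + R Y Z X + R Z X Y = 0 := by
    rw [← cyclicSum_apply, hR.bianchi, zero_apply, zero_apply, zero_apply]
  simpa only [map_add, add_apply, map_zero, zero_apply] using congrArg (fun v => B v W) bianchi

theorem pair_symm (hR : IsCurvatureTensor B R) (X Y Z W : V) :
    B (R X Y Z) W = B (R Z W X) Y := by
  linarith [hR.form_bianchi X Y Z W, hR.form_bianchi Y Z W X, hR.form_bianchi Z W X Y,
    hR.form_bianchi W X Y Z, hR.skew X Y Z W, hR.skew Y Z W X, hR.skew Z W X Y, hR.skew W X Y Z,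
    hR.skew X Z Y W, hR.skew Y W X Z, hR.skew Z X Y W, hR.skew W Y Z X,
    hR.form_antisymm X Z Y W, hR.form_antisymm Y W Z X, hR.form_antisymm Y W X Z]

theorem sub (hR : IsCurvatureTensor B R) (hR' : IsCurvatureTensor B R') :
    IsCurvatureTensor B (R - R') where
  antisymm X Y Z := by
    simp only [sub_apply]
    rw [hR.antisymm, hR'.antisymm, neg_sub_neg, neg_sub]
  skew X Y Z W := by
    simp only [sub_apply, map_sub]
    rw [hR.skew, hR'.skew, neg_sub_neg, neg_sub]
  bianchi := by
    have cyclicSum_sub : cyclicSum (R - R') = cyclicSum R - cyclicSum R' := by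
      ext X Y Z
      simp only [cyclicSum_apply, sub_apply]
      abel
    rw [cyclicSum_sub, hR.bianchi, hR'.bianchi, sub_zero]

theorem eq_zero_of_planes (hB : B.IsInvertible) (hR : IsCurvatureTensor B R)
    (h : ∀ X Y, B (R X Y Y) X = 0) : R = 0 := by
  have polarized (X Y Z : V) : B (R X Y Z) X = 0 := by
    have expanded := h X (Y + Z)
    simp only [map_add, add_apply] at expanded
    linarith [h X Y, h X Z, hR.pair_symm X Y Z X, hR.form_antisymm Z X X Y, hR.skew X Z X Y]
  have swap_outer (X Y Z W : V) : B (R X Y Z) W = -B (R W Y Z) X := by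
    have expanded := polarized (X + W) Y Z
    simp only [map_add, add_apply] at expanded
    linarith [polarized X Y Z, polarized W Y Z]
  have rotate (X Y Z W : V) : B (R X Y Z) W = B (R Y Z X) W := by
    linarith [hR.skew X Y Z W, swap_outer X Y W Z, hR.form_antisymm Z Y W X, hR.skew Y Z W X]
  ext X Y Z
  refine ext_of_form hB fun W => ?_
  simp only [zero_apply, map_zero]
  linarith [hR.form_bianchi X Y Z W, rotate X Y Z W, rotate Y Z X W]

theorem ext_of_planes (hB : B.IsInvertible) (hR : IsCurvatureTensor B R)
    (hR' : IsCurvatureTensor B R') (h : ∀ X Y, B (R X Y Y) X = B (R' X Y Y) X) : R = R' :=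
  sub_eq_zero.mp <| (hR.sub hR').eq_zero_of_planes hB fun X Y => by
    simp only [sub_apply, map_sub, h, sub_self]

theorem apply_eq_zero_of_not_linearIndependent (hR : IsCurvatureTensor B R) {X Y : V}
    (h : ¬LinearIndependent ℝ ![X, Y]) : R X Y = 0 := by
  have : IsAddTorsionFree V := .of_isTorsionFree ℝ V
  have self_eq_zero (X : V) : R X X = 0 := by
    ext Z
    exact self_eq_neg.mp (hR.antisymm X X Z)
  by_cases hX : X = 0
  · rw [hX, map_zero, zero_apply]
  · rw [LinearIndependent.pair_iff' hX, not_forall] at h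
    obtain ⟨a, ha⟩ := h
    rw [← not_not.mp ha, map_smul, self_eq_zero, smul_zero]

theorem ricciForm_comm [FiniteDimensional ℝ V] (hB : IsScalarProduct B)
    (hR : IsCurvatureTensor B R) (X Y : V) : ricciForm R X Y = ricciForm R Y X := by
  rw [ricciForm_eq_trCLM, ricciForm_eq_trCLM]
  refine trCLM_eq_of_adjoint hB.isInvertible fun x y => ?_
  change B (R x X Y) y = B x (R y Y X)
  rw [hB.symm x, hR.pair_symm x X Y y, hR.form_antisymm Y y, hR.skew y Y, neg_neg]

end IsCurvatureTensor

end CurvatureTensor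

section KulkarniNomizu

variable {V : Type*} [NormedAddCommGroup V] [NormedSpace ℝ V]

/-- The map `(X, Y, Z) ↦ b(Y, Z) S X - b(X, Z) S Y`, the building block of the curvature tensors
that come from bilinear forms. -/
noncomputable def wedge (b : V →L[ℝ] V →L[ℝ] ℝ) (S : V →L[ℝ] V) : Curv V :=
  ((ContinuousLinearMap.smulRightL ℝ V V).bilinearComp b S).flip
    - (ContinuousLinearMap.smulRightL ℝ V V).bilinearComp b S

theorem wedge_apply (b : V →L[ℝ] V →L[ℝ] ℝ) (S : V →L[ℝ] V) (X Y Z : V) :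
    wedge b S X Y Z = b Y Z • S X - b X Z • S Y := rfl

/-- The Kulkarni–Nomizu product of the scalar product `B` with the bilinear form `B(T ·, ·)`. -/
noncomputable def kulkarniNomizu (B : V →L[ℝ] V →L[ℝ] ℝ) (T : V →L[ℝ] V) : Curv V :=
  wedge B T + wedge (B.comp T) (ContinuousLinearMap.id ℝ V)

theorem kulkarniNomizu_apply (B : V →L[ℝ] V →L[ℝ] ℝ) (T : V →L[ℝ] V) (X Y Z : V) :
    kulkarniNomizu B T X Y Z =
      B Y Z • T X - B X Z • T Y + (B (T Y) Z • X - B (T X) Z • Y) := rfl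

variable {B : V →L[ℝ] V →L[ℝ] ℝ} {T : V →L[ℝ] V}

theorem isCurvatureTensor_kulkarniNomizu (hB : ∀ v w, B v w = B w v)
    (hT : ∀ v w, B (T v) w = B v (T w)) : IsCurvatureTensor B (kulkarniNomizu B T) where
  antisymm X Y Z := by
    simp only [kulkarniNomizu_apply]
    abel
  skew X Y Z W := by
    simp only [kulkarniNomizu_apply, map_add, map_sub, map_smul, add_apply, sub_apply, smul_apply,
      smul_eq_mul]
    ring
  bianchi := by
    have hBT (v w : V) : B (T v) w = B (T w) v := by rw [hT, hB]
    ext X Y Z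
    simp only [cyclicSum_apply, kulkarniNomizu_apply, zero_apply]
    rw [hB Z X, hB Z Y, hB Y X, hBT Z X, hBT Z Y, hBT Y X]
    abel

variable [FiniteDimensional ℝ V]

theorem ricciForm_add (R R' : Curv V) : ricciForm (R + R') = ricciForm R + ricciForm R' := by
  ext X Y
  exact map_add (trCLM V) ((R.flip X).flip Y) ((R'.flip X).flip Y)

theorem ricciForm_wedge (b : V →L[ℝ] V →L[ℝ] ℝ) (S : V →L[ℝ] V) (X Y : V) :
    ricciForm (wedge b S) X Y = trCLM V S * b X Y - b (S X) Y := by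
  have endomorphism : ((wedge b S).flip X).flip Y = b X Y • S - (b.flip Y).smulRight (S X) := rfl
  rw [ricciForm_eq_trCLM, endomorphism, map_sub, map_smul, trCLM_smulRight, smul_eq_mul, mul_comm,
    ContinuousLinearMap.flip_apply]

theorem ricciEnd_kulkarniNomizu (hB : B.IsInvertible) :
    ricciEnd B (kulkarniNomizu B T) =
      trCLM V T • (1 : V →L[ℝ] V) + ((Module.finrank ℝ V : ℝ) - 2) • T := by
  ext X
  refine ext_of_form hB fun Y => ?_
  rw [ricciEnd, apply_endOfForm hB, kulkarniNomizu, ricciForm_add]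
  simp only [add_apply, smul_apply, map_add, map_smul, smul_eq_mul, ricciForm_wedge, trCLM_id,
    ContinuousLinearMap.comp_apply, ContinuousLinearMap.id_apply, one_apply_eq_self]
  ring

end KulkarniNomizu

section PermeabilityForm

variable {V : Type*} [NormedAddCommGroup V] [NormedSpace ℝ V]

/-- The vector-valued `3`-form `R_{X,Y} (A Z) + R_{Y,Z} (A X) + R_{Z,X} (A Y)`, whose vanishing for
the shape operator `A` is permeability. -/
noncomputable def permeabilityForm (R : Curv V) (A : V →L[ℝ] V) : Curv V :=
  cyclicSum ((ContinuousLinearMap.compL ℝ V (V →L[ℝ] V) (V →L[ℝ] V)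
    ((ContinuousLinearMap.compL ℝ V V V).flip A)).comp R)

theorem permeabilityForm_apply (R : Curv V) (A : V →L[ℝ] V) (X Y Z : V) :
    permeabilityForm R A X Y Z = R X Y (A Z) + R Y Z (A X) + R Z X (A Y) := rfl

theorem permeabilityForm_eq_zero_iff {R : Curv V} {A : V →L[ℝ] V} :
    permeabilityForm R A = 0 ↔ ∀ X Y Z, R X Y (A Z) + R Y Z (A X) + R Z X (A Y) = 0 := by
  simp only [ContinuousLinearMap.ext_iff, permeabilityForm_apply, zero_apply]

theorem permeabilityForm_add (R R' : Curv V) (A : V →L[ℝ] V) :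
    permeabilityForm (R + R') A = permeabilityForm R A + permeabilityForm R' A := by
  ext X Y Z
  simp only [permeabilityForm_apply, add_apply]
  abel

theorem permeabilityForm_wedge_eq_zero {b : V →L[ℝ] V →L[ℝ] ℝ} {A : V →L[ℝ] V}
    (h : ∀ Y Z, b Y (A Z) = b Z (A Y)) (S : V →L[ℝ] V) : permeabilityForm (wedge b S) A = 0 := by
  refine permeabilityForm_eq_zero_iff.mpr fun X Y Z => ?_
  simp only [wedge_apply]
  rw [h Z X, h Y X, h Z Y]
  abel

variable {B : V →L[ℝ] V →L[ℝ] ℝ} {R : Curv V} {A T : V →L[ℝ] V}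

theorem permeabilityForm_kulkarniNomizu_eq_zero (hB : ∀ v w, B v w = B w v)
    (hA : ∀ v w, B (A v) w = B v (A w)) (hT : ∀ v w, B (T v) w = B v (T w)) (hTA : Commute T A) :
    permeabilityForm (kulkarniNomizu B T) A = 0 := by
  have comm (v : V) : T (A v) = A (T v) := congrArg (fun L : V →L[ℝ] V => L v) hTA.eq
  rw [kulkarniNomizu, permeabilityForm_add,
    permeabilityForm_wedge_eq_zero (fun Y Z => by rw [hB Y, hA]),
    permeabilityForm_wedge_eq_zero (fun Y Z => ?_), add_zero]
  calc B (T Y) (A Z) = B (T (A Y)) Z := by rw [← hA, comm]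
    _ = B (T Z) (A Y) := by rw [hT, hB]

variable [FiniteDimensional ℝ V]

theorem trCLM_permeabilityForm (hB : IsScalarProduct B) (hR : IsCurvatureTensor B R)
    (hA : ∀ v w, B (A v) w = B v (A w)) (Y Z : V) :
    trCLM V (permeabilityForm R A Y Z) = B (A (ricciEnd B R Y)) Z - B (ricciEnd B R (A Y)) Z := by
  have trace_comp : trCLM V ((R Y Z).comp A) = 0 := by
    have adjoint : trCLM V ((R Y Z).comp A) = trCLM V (-(A.comp (R Y Z))) :=
      trCLM_eq_of_adjoint hB.isInvertible fun x y => by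
        simp only [ContinuousLinearMap.comp_apply, neg_apply, map_neg]
        rw [hR.skew, hB.symm, hA]
    rw [map_neg, trCLM_comp_comm A] at adjoint
    linarith
  have endomorphism : permeabilityForm R A Y Z =
      (R Y Z).comp A - (R.flip Z).flip (A Y) + (R.flip Y).flip (A Z) := by
    ext X
    change R Y Z (A X) + R Z X (A Y) + R X Y (A Z) = R Y Z (A X) - R X Z (A Y) + R X Y (A Z)
    rw [hR.antisymm Z X, sub_eq_add_neg]
  rw [endomorphism, map_add, map_sub, trace_comp, ← ricciForm_eq_trCLM, ← ricciForm_eq_trCLM, hA,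
    ricciEnd, apply_endOfForm hB.isInvertible, apply_endOfForm hB.isInvertible,
    hR.ricciForm_comm hB Z]
  ring

theorem commute_ricciEnd_iff (hB : IsScalarProduct B) (hR : IsCurvatureTensor B R)
    (hA : ∀ v w, B (A v) w = B v (A w)) :
    Commute (ricciEnd B R) A ↔ ∀ Y Z, trCLM V (permeabilityForm R A Y Z) = 0 := by
  simp only [trCLM_permeabilityForm hB hR hA, sub_eq_zero]
  refine ⟨fun h Y Z => ?_, fun h => ContinuousLinearMap.ext fun Y => ?_⟩
  · exact congrArg (fun L : V →L[ℝ] V => B (L Y) Z) h.eq.symm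
  · exact ext_of_form hB.isInvertible fun Z => (h Y Z).symm

theorem commute_ricciEnd_of_permeabilityForm_eq_zero (hB : IsScalarProduct B)
    (hR : IsCurvatureTensor B R) (hA : ∀ v w, B (A v) w = B v (A w))
    (h : permeabilityForm R A = 0) : Commute (ricciEnd B R) A :=
  (commute_ricciEnd_iff hB hR hA).mpr fun Y Z => by
    rw [h, zero_apply, zero_apply, map_zero]

theorem permeabilityForm_eq_zero_of_commute_ricciEnd_of_finrank_eq_three (hB : IsScalarProduct B)
    (hR : IsCurvatureTensor B R) (hA : ∀ v w, B (A v) w = B v (A w))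
    (hV : Module.finrank ℝ V = 3) (h : Commute (ricciEnd B R) A) : permeabilityForm R A = 0 :=
  cyclicSum_eq_zero_of_trCLM_eq_zero (fun X Y Z => hR.antisymm X Y (A Z)) hV
    ((commute_ricciEnd_iff hB hR hA).mp h)

theorem permeabilityForm_kulkarniNomizu_eq_zero_of_commute_ricciEnd (hB : IsScalarProduct B)
    (hA : ∀ v w, B (A v) w = B v (A w)) (hT : ∀ v w, B (T v) w = B v (T w))
    (h : Commute (ricciEnd B (kulkarniNomizu B T)) A) :
    permeabilityForm (kulkarniNomizu B T) A = 0 := by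
  obtain finrank_eq | finrank_ne := eq_or_ne (Module.finrank ℝ V) 2
  · have hR := isCurvatureTensor_kulkarniNomizu hB.symm hT
    exact cyclicSum_eq_zero_of_finrank_lt (fun X Y Z => hR.antisymm X Y (A Z)) (by omega)
  · refine permeabilityForm_kulkarniNomizu_eq_zero hB.symm hA hT ?_
    have ne_zero : (Module.finrank ℝ V : ℝ) - 2 ≠ 0 := sub_ne_zero.mpr (mod_cast finrank_ne)
    rw [ricciEnd_kulkarniNomizu hB.isInvertible] at h
    have smul_commute := h.sub_left ((Commute.one_left A).smul_left (trCLM V T))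
    rwa [add_sub_cancel_left, Commute.smul_left_iff₀ ne_zero] at smul_commute

end PermeabilityForm

section LocalMetric

variable {W : Type*} [NormedAddCommGroup W] [NormedSpace ℝ W] {G : W → W →L[ℝ] W →L[ℝ] ℝ} {x : W}

/-- `G` is a twice continuously differentiable scalar product near `x`. The inverse of a continuous
linear equivalence depends continuously on it, so it is enough to ask for invertibility at `x`. -/
structure IsMetricAt (G : W → W →L[ℝ] W →L[ℝ] ℝ) (x : W) : Prop where
  contDiffAt : ContDiffAt ℝ 2 G x
  symm : ∀ᶠ y in 𝓝 x, ∀ v w, G y v w = G y w v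
  isInvertible : (G x).IsInvertible

namespace IsMetricAt

theorem isScalarProduct (h : IsMetricAt G x) : IsScalarProduct (G x) :=
  ⟨h.symm.self_of_nhds, h.isInvertible⟩

theorem differentiableAt (h : IsMetricAt G x) : DifferentiableAt ℝ G x :=
  h.contDiffAt.differentiableAt (by norm_num)

theorem eventually [CompleteSpace W] (h : IsMetricAt G x) : ∀ᶠ y in 𝓝 x, IsMetricAt G y := by
  have invertible : ∀ᶠ y in 𝓝 x, (G y).IsInvertible := by
    obtain ⟨e, he⟩ := h.isInvertible
    exact h.contDiffAt.continuousAt.eventually (he ▸ e.nhds)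
  filter_upwards [h.contDiffAt.eventually (by simp), h.symm.eventually_nhds, invertible]
    with y contDiffAt symm isInvertible
  exact ⟨contDiffAt, symm, isInvertible⟩

theorem fderiv_symm (h : IsMetricAt G x) (u v w : W) :
    fderiv ℝ G x u v w = fderiv ℝ G x u w v := by
  have flip_eq : (fun y => (G y).flip) =ᶠ[𝓝 x] G :=
    h.symm.mono fun y hy => by ext v w; exact hy w v
  have fderiv_flip : fderiv ℝ (fun y => (G y).flip) x u = (fderiv ℝ G x u).flip :=
    congrArg (· u) ((ContinuousLinearMap.flipₗᵢ ℝ W W ℝ).toContinuousLinearEquiv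
      |>.comp_fderiv (f := G) (x := x))
  rw [flip_eq.fderiv_eq] at fderiv_flip
  exact congrArg (fun b : W →L[ℝ] W →L[ℝ] ℝ => b v w) fderiv_flip

theorem apply_christoffel (h : IsMetricAt G x) (v w z : W) :
    G x (christoffel G x v w) z = christoffelFirst G x v w z :=
  apply_sharp h.isInvertible _ z

theorem christoffel_symm (h : IsMetricAt G x) (v w : W) :
    christoffel G x v w = christoffel G x w v := by
  refine ext_of_form h.isInvertible fun z => ?_
  rw [h.apply_christoffel, h.apply_christoffel, christoffelFirst_apply, christoffelFirst_apply,
    h.fderiv_symm z v w, add_comm (fderiv ℝ G x v w z)]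

theorem fderiv_eq_christoffel (h : IsMetricAt G x) (u v w : W) :
    fderiv ℝ G x u v w = G x (christoffel G x u v) w + G x v (christoffel G x u w) := by
  rw [h.isScalarProduct.symm v, h.apply_christoffel, h.apply_christoffel, christoffelFirst_apply,
    christoffelFirst_apply, h.fderiv_symm v u w, h.fderiv_symm u w v, h.fderiv_symm w u v]
  ring

theorem contDiffAt_christoffel [CompleteSpace W] (h : IsMetricAt G x) :
    ContDiffAt ℝ 1 (christoffel G) x := by
  have contDiffAt_fderiv : ContDiffAt ℝ 1 (fderiv ℝ G) x := h.contDiffAt.fderiv_right (by norm_num)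
  have contDiffAt_flip : ContDiffAt ℝ 1 (fun y => (fderiv ℝ G y).flip) x :=
    (ContinuousLinearMap.flipₗᵢ ℝ W W (W →L[ℝ] ℝ)).toContinuousLinearEquiv.contDiff.contDiffAt.comp
      x contDiffAt_fderiv
  have contDiffAt_christoffelFirst : ContDiffAt ℝ 1 (christoffelFirst G) x :=
    ((contDiffAt_fderiv.add contDiffAt_flip).sub
      (contDiffAt_const.clm_comp contDiffAt_flip)).const_smul (1 / 2 : ℝ)
  have contDiffAt_sharp : ContDiffAt ℝ 1 (fun y => sharp (G y)) x :=
    h.isInvertible.contDiffAt_map_inverse.comp x (h.contDiffAt.of_le (by norm_num))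
  exact ((ContinuousLinearMap.compL ℝ W (W →L[ℝ] ℝ) W).contDiff.contDiffAt.comp
    x contDiffAt_sharp).clm_comp contDiffAt_christoffelFirst

theorem differentiableAt_christoffel [CompleteSpace W] (h : IsMetricAt G x) :
    DifferentiableAt ℝ (christoffel G) x :=
  h.contDiffAt_christoffel.differentiableAt (by norm_num)

end IsMetricAt

end LocalMetric

section CovariantDerivative

variable {V W : Type*} [NormedAddCommGroup V] [NormedSpace ℝ V]
  [NormedAddCommGroup W] [NormedSpace ℝ W]

theorem hasFDerivAt_fderiv {f : V → W} {x : V} (hf : ContDiffAt ℝ 2 f x) :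
    HasFDerivAt (fderiv ℝ f) (fderiv ℝ (fderiv ℝ f) x) x :=
  ((hf.fderiv_right (m := 1) (by norm_num)).differentiableAt (by norm_num)).hasFDerivAt

theorem fderiv_apply_const_apply_const {b : V → W →L[ℝ] W →L[ℝ] ℝ} {x : V}
    (hb : DifferentiableAt ℝ b x) (u : V) (v w : W) :
    fderiv ℝ (fun y => b y v w) x u = fderiv ℝ b x u v w := by
  rw [((hb.hasFDerivAt.clm_apply (hasFDerivAt_const v x)).clm_apply
    (hasFDerivAt_const w x)).fderiv]
  simp only [add_apply, ContinuousLinearMap.comp_apply, zero_apply, map_zero, zero_add,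
    ContinuousLinearMap.flip_apply]

/-- The covariant derivative `∇_u ξ` at `x` of a vector field `ξ` along the map `F`, for the
Levi-Civita connection of the metric `G` on the target of `F`. -/
noncomputable def covariantDerivAlong (G : W → W →L[ℝ] W →L[ℝ] ℝ) (F ξ : V → W) (x u : V) : W :=
  fderiv ℝ ξ x u + christoffel G (F x) (fderiv ℝ F x u) (ξ x)

variable {G : W → W →L[ℝ] W →L[ℝ] ℝ} {F ξ η : V → W} {x : V}

theorem covariantDerivAlong_id (G : W → W →L[ℝ] W →L[ℝ] ℝ) (ξ : W → W) (x u : W) :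
    covariantDerivAlong G id ξ x u = fderiv ℝ ξ x u + christoffel G x u (ξ x) := by
  rw [covariantDerivAlong, fderiv_id, id, ContinuousLinearMap.id_apply]

theorem covariantDerivAlong_add (hξ : DifferentiableAt ℝ ξ x) (hη : DifferentiableAt ℝ η x)
    (u : V) : covariantDerivAlong G F (fun y => ξ y + η y) x u =
      covariantDerivAlong G F ξ x u + covariantDerivAlong G F η x u := by
  rw [covariantDerivAlong, fderiv_fun_add hξ hη, add_apply, map_add]
  simp only [covariantDerivAlong]
  abel

theorem covariantDerivAlong_congr (h : ξ =ᶠ[𝓝 x] η) (u : V) :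
    covariantDerivAlong G F ξ x u = covariantDerivAlong G F η x u := by
  rw [covariantDerivAlong, covariantDerivAlong, h.fderiv_eq, h.self_of_nhds]

namespace IsMetricAt

theorem fderiv_apply_apply (hG : IsMetricAt G (F x)) (hF : DifferentiableAt ℝ F x)
    (hξ : DifferentiableAt ℝ ξ x) (hη : DifferentiableAt ℝ η x) (u : V) :
    fderiv ℝ (fun y => G (F y) (ξ y) (η y)) x u =
      G (F x) (covariantDerivAlong G F ξ x u) (η x)
        + G (F x) (ξ x) (covariantDerivAlong G F η x u) := by
  have product_rule := ((hG.differentiableAt.hasFDerivAt.comp x hF.hasFDerivAt).clm_apply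
    hξ.hasFDerivAt).clm_apply hη.hasFDerivAt
  rw [show fderiv ℝ (fun y => G (F y) (ξ y) (η y)) x = _ from product_rule.fderiv]
  simp only [Function.comp_apply, add_apply, ContinuousLinearMap.comp_apply,
    ContinuousLinearMap.flip_apply, covariantDerivAlong, map_add, hG.fderiv_eq_christoffel]
  ring

variable [CompleteSpace W]

theorem differentiableAt_covariantDerivAlong (hG : IsMetricAt G (F x)) (hF : ContDiffAt ℝ 2 F x)
    (hξ : ContDiffAt ℝ 2 ξ x) (v : V) :
    DifferentiableAt ℝ (fun y => covariantDerivAlong G F ξ y v) x := by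
  have fderiv_ξ : DifferentiableAt ℝ (fderiv ℝ ξ) x := (hasFDerivAt_fderiv hξ).differentiableAt
  have fderiv_F : DifferentiableAt ℝ (fderiv ℝ F) x := (hasFDerivAt_fderiv hF).differentiableAt
  have christoffel_F : DifferentiableAt ℝ (fun y => christoffel G (F y)) x :=
    hG.differentiableAt_christoffel.comp x (hF.differentiableAt (by norm_num))
  exact (fderiv_ξ.clm_apply (differentiableAt_const v)).add
    ((christoffel_F.clm_apply (fderiv_F.clm_apply (differentiableAt_const v))).clm_apply
      (hξ.differentiableAt (by norm_num)))

theorem covariantDerivAlong_covariantDerivAlong (hG : IsMetricAt G (F x))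
    (hF : ContDiffAt ℝ 2 F x) (hξ : ContDiffAt ℝ 2 ξ x) (u v : V) :
    covariantDerivAlong G F (fun y => covariantDerivAlong G F ξ y v) x u =
      fderiv ℝ (fderiv ℝ ξ) x u v + christoffel G (F x) (fderiv ℝ (fderiv ℝ F) x u v) (ξ x)
        + christoffel G (F x) (fderiv ℝ F x u) (fderiv ℝ ξ x v)
        + christoffel G (F x) (fderiv ℝ F x v) (fderiv ℝ ξ x u)
        + secondCovariant G (F x) (fderiv ℝ F x u) (fderiv ℝ F x v) (ξ x) := by
  have hasFDerivAt_self {f : V → W} (hf : ContDiffAt ℝ 2 f x) : HasFDerivAt f (fderiv ℝ f x) x :=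
    (hf.differentiableAt (by norm_num)).hasFDerivAt
  have product_rule := ((hasFDerivAt_fderiv hξ).clm_apply (hasFDerivAt_const v x)).add
    (((hG.differentiableAt_christoffel.hasFDerivAt.comp x (hasFDerivAt_self hF)).clm_apply
      ((hasFDerivAt_fderiv hF).clm_apply (hasFDerivAt_const v x))).clm_apply (hasFDerivAt_self hξ))
  rw [covariantDerivAlong,
    show fderiv ℝ (fun y => covariantDerivAlong G F ξ y v) x = _ from product_rule.fderiv]
  simp only [Function.comp_apply, add_apply, ContinuousLinearMap.comp_apply, zero_apply, map_zero,
    ContinuousLinearMap.flip_apply, covariantDerivAlong, map_add, secondCovariant_apply, zero_add]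
  abel

theorem localCurvature_eq (hG : IsMetricAt G (F x)) (hF : ContDiffAt ℝ 2 F x)
    (hξ : ContDiffAt ℝ 2 ξ x) (u v : V) :
    localCurvature G (F x) (fderiv ℝ F x u) (fderiv ℝ F x v) (ξ x) =
      covariantDerivAlong G F (fun y => covariantDerivAlong G F ξ y v) x u
        - covariantDerivAlong G F (fun y => covariantDerivAlong G F ξ y u) x v := by
  rw [hG.covariantDerivAlong_covariantDerivAlong hF hξ,
    hG.covariantDerivAlong_covariantDerivAlong hF hξ, localCurvature_apply,
    (hξ.isSymmSndFDerivAt (by simp)).eq u v, (hF.isSymmSndFDerivAt (by simp)).eq u v]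
  abel

end IsMetricAt

end CovariantDerivative

section LocalCurvatureTensor

variable {V : Type*} [NormedAddCommGroup V] [NormedSpace ℝ V]
  {G : V → V →L[ℝ] V →L[ℝ] ℝ} {x : V}

namespace IsMetricAt

theorem fderiv_apply_vectorFields {ξ η : V → V} (h : IsMetricAt G x)
    (hξ : DifferentiableAt ℝ ξ x) (hη : DifferentiableAt ℝ η x) (u : V) :
    fderiv ℝ (fun y => G y (ξ y) (η y)) x u =
      G x (covariantDerivAlong G id ξ x u) (η x) + G x (ξ x) (covariantDerivAlong G id η x u) :=
  h.fderiv_apply_apply (F := id) differentiableAt_id hξ hη u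

variable [CompleteSpace V]

theorem covariantDerivAlong_christoffel (h : IsMetricAt G x) (u v w : V) :
    covariantDerivAlong G id (fun y => christoffel G y v w) x u = secondCovariant G x u v w := by
  have product_rule := (h.differentiableAt_christoffel.hasFDerivAt.clm_apply
    (hasFDerivAt_const v x)).clm_apply (hasFDerivAt_const w x)
  rw [covariantDerivAlong_id, product_rule.fderiv]
  simp only [add_apply, ContinuousLinearMap.comp_apply, zero_apply, map_zero, zero_add,
    ContinuousLinearMap.flip_apply, secondCovariant_apply]

theorem secondCovariant_symm (h : IsMetricAt G x) (u v w : V) :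
    secondCovariant G x u v w = secondCovariant G x u w v := by
  rw [← h.covariantDerivAlong_christoffel, ← h.covariantDerivAlong_christoffel]
  exact covariantDerivAlong_congr (h.eventually.mono fun y hy => hy.christoffel_symm v w) u

theorem fderiv_fderiv_apply (h : IsMetricAt G x) (u v w z : V) :
    fderiv ℝ (fderiv ℝ G) x u v w z =
      G x (secondCovariant G x u v w) z + G x (christoffel G x v w) (christoffel G x u z)
        + (G x (christoffel G x u w) (christoffel G x v z)
          + G x w (secondCovariant G x u v z)) := by
  have differentiable_christoffel (w : V) : DifferentiableAt ℝ (fun y => christoffel G y v w) x :=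
    (h.differentiableAt_christoffel.clm_apply (differentiableAt_const v)).clm_apply
      (differentiableAt_const w)
  have differentiable_G {ξ η : V → V} (hξ : DifferentiableAt ℝ ξ x)
      (hη : DifferentiableAt ℝ η x) : DifferentiableAt ℝ (fun y => G y (ξ y) (η y)) x :=
    (h.differentiableAt.clm_apply hξ).clm_apply hη
  have covariantDeriv_const (w : V) :
      covariantDerivAlong G id (fun _ => w) x u = christoffel G x u w := by
    rw [covariantDerivAlong_id, fderiv_fun_const, Pi.zero_apply, zero_apply, zero_add]
  have fderiv_eq : (fun y => fderiv ℝ G y v w z) =ᶠ[𝓝 x] fun y =>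
      G y (christoffel G y v w) z + G y w (christoffel G y v z) :=
    h.eventually.mono fun y hy => hy.fderiv_eq_christoffel v w z
  have fderiv_fderiv_G := hasFDerivAt_fderiv h.contDiffAt
  calc fderiv ℝ (fderiv ℝ G) x u v w z = fderiv ℝ (fun y => fderiv ℝ G y v w z) x u := by
        rw [fderiv_apply_const_apply_const
            (fderiv_fderiv_G.differentiableAt.clm_apply (differentiableAt_const v)),
          (fderiv_fderiv_G.clm_apply (hasFDerivAt_const v x)).fderiv]
        simp only [add_apply, ContinuousLinearMap.comp_apply, zero_apply, map_zero, zero_add,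
          ContinuousLinearMap.flip_apply]
    _ = _ := by
        rw [fderiv_eq.fderiv_eq, fderiv_fun_add
          (differentiable_G (differentiable_christoffel w) (differentiableAt_const z))
          (differentiable_G (differentiableAt_const w) (differentiable_christoffel z)), add_apply,
          h.fderiv_apply_vectorFields (differentiable_christoffel w) (differentiableAt_const z),
          h.fderiv_apply_vectorFields (differentiableAt_const w) (differentiable_christoffel z)]
        simp only [h.covariantDerivAlong_christoffel, covariantDeriv_const]

theorem isCurvatureTensor (h : IsMetricAt G x) :
    IsCurvatureTensor (G x) (localCurvature G x) where
  antisymm u v w := by rw [localCurvature_apply, localCurvature_apply, neg_sub]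
  skew u v w z := by
    have second_symm : fderiv ℝ (fderiv ℝ G) x u v w z = fderiv ℝ (fderiv ℝ G) x v u w z := by
      rw [(h.contDiffAt.isSymmSndFDerivAt (by simp)).eq u v]
    rw [h.fderiv_fderiv_apply, h.fderiv_fderiv_apply] at second_symm
    simp only [localCurvature_apply, map_sub, sub_apply]
    rw [h.isScalarProduct.symm _ w, h.isScalarProduct.symm _ w]
    linarith
  bianchi := by
    ext u v w
    simp only [cyclicSum_apply, localCurvature_apply, zero_apply]
    rw [h.secondCovariant_symm u w v, h.secondCovariant_symm v u w, h.secondCovariant_symm w v u]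
    abel

end IsMetricAt

end LocalCurvatureTensor

section LocalGauss

variable {V W : Type*} [NormedAddCommGroup V] [NormedSpace ℝ V]
  [NormedAddCommGroup W] [NormedSpace ℝ W]

/-- The pullback `F^*G` of the metric `G` by the map `F` between vector spaces. -/
noncomputable def localPullback (F : V → W) (G : W → W →L[ℝ] W →L[ℝ] ℝ) (x : V) :
    V →L[ℝ] V →L[ℝ] ℝ :=
  (G (F x)).bilinearComp (fderiv ℝ F x) (fderiv ℝ F x)

theorem localPullback_apply (F : V → W) (G : W → W →L[ℝ] W →L[ℝ] ℝ) (x v w : V) :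
    localPullback F G x v w = G (F x) (fderiv ℝ F x v) (fderiv ℝ F x w) := rfl

/-- `F` is near `x` an immersion into a space with metric `G` such that the induced metric is
nondegenerate; it is smooth enough for the curvature of the induced metric to exist. -/
structure IsNondegenerateImmersionAt (F : V → W) (G : W → W →L[ℝ] W →L[ℝ] ℝ) (x : V) :
    Prop where
  contDiffAt : ContDiffAt ℝ 3 F x
  isMetricAt : IsMetricAt G (F x)
  isInvertible : (localPullback F G x).IsInvertible

/-- The second fundamental form of `F` with values in the normal space, that is the difference
`∇_v (dF w) - dF (∇_v w)` for constant vector fields `v, w`. -/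
noncomputable def localHessian (F : V → W) (G : W → W →L[ℝ] W →L[ℝ] ℝ) (x v w : V) : W :=
  fderiv ℝ (fderiv ℝ F) x v w + christoffel G (F x) (fderiv ℝ F x v) (fderiv ℝ F x w)
    - fderiv ℝ F x (christoffel (localPullback F G) x v w)

variable {F : V → W} {G : W → W →L[ℝ] W →L[ℝ] ℝ} {x : V}

theorem covariantDerivAlong_fderiv_apply (hF : ContDiffAt ℝ 2 F x) {η : V → V}
    (hη : DifferentiableAt ℝ η x) (u : V) :
    covariantDerivAlong G F (fun y => fderiv ℝ F y (η y)) x u =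
      fderiv ℝ (fderiv ℝ F) x u (η x) + fderiv ℝ F x (fderiv ℝ η x u)
        + christoffel G (F x) (fderiv ℝ F x u) (fderiv ℝ F x (η x)) := by
  rw [covariantDerivAlong, ((hasFDerivAt_fderiv hF).clm_apply hη.hasFDerivAt).fderiv, add_apply,
    ContinuousLinearMap.comp_apply, ContinuousLinearMap.flip_apply,
    add_comm (fderiv ℝ F x (fderiv ℝ η x u))]

theorem gauss_formula (hF : ContDiffAt ℝ 2 F x) {η : V → V} (hη : DifferentiableAt ℝ η x)
    (u : V) :
    covariantDerivAlong G F (fun y => fderiv ℝ F y (η y)) x u =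
      fderiv ℝ F x (covariantDerivAlong (localPullback F G) id η x u)
        + localHessian F G x u (η x) := by
  rw [covariantDerivAlong_fderiv_apply hF hη, covariantDerivAlong_id, localHessian, map_add]
  abel

theorem gauss_formula_const (hF : ContDiffAt ℝ 2 F x) (v w : V) :
    covariantDerivAlong G F (fun y => fderiv ℝ F y w) x v =
      fderiv ℝ F x (christoffel (localPullback F G) x v w) + localHessian F G x v w := by
  rw [gauss_formula hF (differentiableAt_const w), covariantDerivAlong_id, fderiv_fun_const,
    Pi.zero_apply, zero_apply, zero_add]

namespace IsNondegenerateImmersionAt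

theorem contDiffAt_two (h : IsNondegenerateImmersionAt F G x) : ContDiffAt ℝ 2 F x :=
  h.contDiffAt.of_le (by norm_num)

theorem differentiableAt (h : IsNondegenerateImmersionAt F G x) : DifferentiableAt ℝ F x :=
  h.contDiffAt.differentiableAt (by norm_num)

theorem contDiffAt_fderiv (h : IsNondegenerateImmersionAt F G x) : ContDiffAt ℝ 2 (fderiv ℝ F) x :=
  h.contDiffAt.fderiv_right (by norm_num)

theorem isMetricAt_localPullback (h : IsNondegenerateImmersionAt F G x) :
    IsMetricAt (localPullback F G) x where
  contDiffAt :=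
    ((ContinuousLinearMap.compL ℝ V W ℝ).flip.contDiff.contDiffAt.comp x h.contDiffAt_fderiv)
      |>.clm_comp ((h.isMetricAt.contDiffAt.comp x h.contDiffAt_two).clm_comp h.contDiffAt_fderiv)
  symm := (h.contDiffAt.continuousAt.eventually h.isMetricAt.symm).mono fun _ hy _ _ => hy _ _
  isInvertible := h.isInvertible

theorem covariantDerivAlong_fderiv_symm (h : IsNondegenerateImmersionAt F G x) (v w : V) :
    covariantDerivAlong G F (fun y => fderiv ℝ F y w) x v =
      covariantDerivAlong G F (fun y => fderiv ℝ F y v) x w := by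
  rw [covariantDerivAlong_fderiv_apply h.contDiffAt_two (differentiableAt_const w),
    covariantDerivAlong_fderiv_apply h.contDiffAt_two (differentiableAt_const v),
    h.isMetricAt.christoffel_symm, (h.contDiffAt_two.isSymmSndFDerivAt (by simp)).eq v w]
  simp only [fderiv_fun_const, Pi.zero_apply, zero_apply]

theorem localHessian_symm (h : IsNondegenerateImmersionAt F G x) (v w : V) :
    localHessian F G x v w = localHessian F G x w v := by
  have gauss_symm := h.covariantDerivAlong_fderiv_symm v w
  rw [gauss_formula_const h.contDiffAt_two, gauss_formula_const h.contDiffAt_two,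
    h.isMetricAt_localPullback.christoffel_symm] at gauss_symm
  exact add_left_cancel gauss_symm

theorem fderiv_localPullback (h : IsNondegenerateImmersionAt F G x) (u v w : V) :
    fderiv ℝ (localPullback F G) x u v w =
      G (F x) (covariantDerivAlong G F (fun y => fderiv ℝ F y v) x u) (fderiv ℝ F x w)
        + G (F x) (covariantDerivAlong G F (fun y => fderiv ℝ F y w) x u) (fderiv ℝ F x v) := by
  have fderiv_F (v : V) : DifferentiableAt ℝ (fun y => fderiv ℝ F y v) x :=
    (h.contDiffAt_fderiv.differentiableAt (by norm_num)).clm_apply (differentiableAt_const v)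
  rw [h.isMetricAt.isScalarProduct.symm _ (fderiv ℝ F x v),
    ← h.isMetricAt.fderiv_apply_apply h.differentiableAt (fderiv_F v) (fderiv_F w),
    ← fderiv_apply_const_apply_const h.isMetricAt_localPullback.differentiableAt]
  rfl

theorem christoffelFirst_localPullback (h : IsNondegenerateImmersionAt F G x) (v w z : V) :
    christoffelFirst (localPullback F G) x v w z =
      G (F x) (covariantDerivAlong G F (fun y => fderiv ℝ F y w) x v) (fderiv ℝ F x z) := by
  rw [christoffelFirst_apply, h.fderiv_localPullback, h.fderiv_localPullback,
    h.fderiv_localPullback, h.covariantDerivAlong_fderiv_symm z v,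
    h.covariantDerivAlong_fderiv_symm z w, h.covariantDerivAlong_fderiv_symm w v]
  ring

theorem apply_localHessian_fderiv (h : IsNondegenerateImmersionAt F G x) (v w z : V) :
    G (F x) (localHessian F G x v w) (fderiv ℝ F x z) = 0 := by
  have christoffel_eq := h.isMetricAt_localPullback.apply_christoffel v w z
  rw [h.christoffelFirst_localPullback, gauss_formula_const h.contDiffAt_two, map_add, add_apply,
    localPullback_apply] at christoffel_eq
  linarith

variable [CompleteSpace V]

theorem differentiableAt_fderiv_christoffel (h : IsNondegenerateImmersionAt F G x) (v w : V) :
    DifferentiableAt ℝ (fun y => fderiv ℝ F y (christoffel (localPullback F G) y v w)) x :=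
  (h.contDiffAt_fderiv.differentiableAt (by norm_num)).clm_apply
    ((h.isMetricAt_localPullback.differentiableAt_christoffel.clm_apply
      (differentiableAt_const v)).clm_apply (differentiableAt_const w))

variable [CompleteSpace W]

theorem eventually (h : IsNondegenerateImmersionAt F G x) :
    ∀ᶠ y in 𝓝 x, IsNondegenerateImmersionAt F G y := by
  filter_upwards [h.contDiffAt.eventually (by simp),
    h.contDiffAt.continuousAt.eventually h.isMetricAt.eventually,
    h.isMetricAt_localPullback.eventually] with y contDiffAt isMetricAt isMetricAt_localPullback
  exact ⟨contDiffAt, isMetricAt, isMetricAt_localPullback.isInvertible⟩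

theorem eventuallyEq_covariantDerivAlong_fderiv (h : IsNondegenerateImmersionAt F G x) (v w : V) :
    (fun y => covariantDerivAlong G F (fun y => fderiv ℝ F y w) y v) =ᶠ[𝓝 x] fun y =>
      fderiv ℝ F y (christoffel (localPullback F G) y v w) + localHessian F G y v w :=
  h.eventually.mono fun _ hy => gauss_formula_const hy.contDiffAt_two v w

theorem differentiableAt_localHessian (h : IsNondegenerateImmersionAt F G x) (v w : V) :
    DifferentiableAt ℝ (fun y => localHessian F G y v w) x := by
  have differentiableAt_covariantDerivAlong := h.isMetricAt.differentiableAt_covariantDerivAlong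
    h.contDiffAt_two (h.contDiffAt_fderiv.clm_apply (contDiffAt_const (c := w))) v
  refine (differentiableAt_covariantDerivAlong.sub
    (h.differentiableAt_fderiv_christoffel v w)).congr_of_eventuallyEq ?_
  filter_upwards [h.eventuallyEq_covariantDerivAlong_fderiv v w] with y hy
  rw [Pi.sub_apply, hy, add_sub_cancel_left]

theorem apply_covariantDerivAlong_localHessian (h : IsNondegenerateImmersionAt F G x)
    (u v w z : V) :
    G (F x) (covariantDerivAlong G F (fun y => localHessian F G y v w) x u) (fderiv ℝ F x z) =
      -G (F x) (localHessian F G x v w) (localHessian F G x u z) := by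
  have fderiv_F : DifferentiableAt ℝ (fun y => fderiv ℝ F y z) x :=
    (h.contDiffAt_fderiv.differentiableAt (by norm_num)).clm_apply (differentiableAt_const z)
  have orthogonal : (fun y => G (F y) (localHessian F G y v w) (fderiv ℝ F y z)) =ᶠ[𝓝 x] 0 :=
    h.eventually.mono fun _ hy => hy.apply_localHessian_fderiv v w z
  have product_rule := h.isMetricAt.fderiv_apply_apply h.differentiableAt
    (h.differentiableAt_localHessian v w) fderiv_F u
  rw [orthogonal.fderiv_eq, fderiv_zero, gauss_formula_const h.contDiffAt_two, map_add,
    h.apply_localHessian_fderiv, zero_add] at product_rule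
  exact eq_neg_of_add_eq_zero_left product_rule.symm

theorem apply_covariantDerivAlong_covariantDerivAlong (h : IsNondegenerateImmersionAt F G x)
    (u v w z : V) :
    G (F x) (covariantDerivAlong G F
        (fun y => covariantDerivAlong G F (fun y => fderiv ℝ F y w) y v) x u) (fderiv ℝ F x z) =
      localPullback F G x (secondCovariant (localPullback F G) x u v w) z
        - G (F x) (localHessian F G x v w) (localHessian F G x u z) := by
  have differentiableAt_christoffel :
      DifferentiableAt ℝ (fun y => christoffel (localPullback F G) y v w) x :=
    (h.isMetricAt_localPullback.differentiableAt_christoffel.clm_apply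
      (differentiableAt_const v)).clm_apply (differentiableAt_const w)
  rw [covariantDerivAlong_congr (h.eventuallyEq_covariantDerivAlong_fderiv v w),
    covariantDerivAlong_add (h.differentiableAt_fderiv_christoffel v w)
      (h.differentiableAt_localHessian v w), gauss_formula h.contDiffAt_two
      differentiableAt_christoffel, h.isMetricAt_localPullback.covariantDerivAlong_christoffel]
  simp only [map_add, add_apply, h.apply_localHessian_fderiv,
    h.apply_covariantDerivAlong_localHessian, localPullback_apply]
  ring

theorem gauss_equation (h : IsNondegenerateImmersionAt F G x) (u v w z : V) :
    localPullback F G x (localCurvature (localPullback F G) x u v w) z =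
      G (F x) (localCurvature G (F x) (fderiv ℝ F x u) (fderiv ℝ F x v) (fderiv ℝ F x w))
          (fderiv ℝ F x z)
        + G (F x) (localHessian F G x v w) (localHessian F G x u z)
        - G (F x) (localHessian F G x u w) (localHessian F G x v z) := by
  rw [h.isMetricAt.localCurvature_eq h.contDiffAt_two
      (h.contDiffAt_fderiv.clm_apply (contDiffAt_const (c := w))), map_sub, sub_apply,
    h.apply_covariantDerivAlong_covariantDerivAlong,
    h.apply_covariantDerivAlong_covariantDerivAlong, localCurvature_apply, map_sub, sub_apply]
  ring

end IsNondegenerateImmersionAt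

end LocalGauss

section Conformal

variable {V : Type*} [NormedAddCommGroup V] [NormedSpace ℝ V]

/-- The conformal change `e^{2ψ} G` of the metric `G`. -/
noncomputable def conformalMetric (ψ : V → ℝ) (G : V → V →L[ℝ] V →L[ℝ] ℝ) (x : V) :
    V →L[ℝ] V →L[ℝ] ℝ :=
  Real.exp (2 * ψ x) • G x

/-- The gradient of `ψ` with respect to the metric `G`. -/
noncomputable def localGradient (G : V → V →L[ℝ] V →L[ℝ] ℝ) (ψ : V → ℝ) (x : V) : V :=
  sharp (G x) (fderiv ℝ ψ x)

/-- The difference `∇^{e^{2ψ}G}_v w - ∇^G_v w` of Levi-Civita connections. -/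
noncomputable def conformalDifference (G : V → V →L[ℝ] V →L[ℝ] ℝ) (ψ : V → ℝ) (x v w : V) : V :=
  fderiv ℝ ψ x v • w + fderiv ℝ ψ x w • v - G x v w • localGradient G ψ x

/-- The endomorphism `∇ grad ψ - dψ ⊗ grad ψ + ½ |dψ|²`, which describes the change of the curvature
tensor from `G` to `e^{2ψ} G`. -/
noncomputable def conformalSchouten (G : V → V →L[ℝ] V →L[ℝ] ℝ) (ψ : V → ℝ) (x : V) : V →L[ℝ] V :=
  fderiv ℝ (localGradient G ψ) x + (christoffel G x).flip (localGradient G ψ x)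
    - (fderiv ℝ ψ x).smulRight (localGradient G ψ x)
    + (1 / 2 * fderiv ℝ ψ x (localGradient G ψ x)) • ContinuousLinearMap.id ℝ V

variable {G : V → V →L[ℝ] V →L[ℝ] ℝ} {x : V} {ψ : V → ℝ}

theorem conformalMetric_apply (ψ : V → ℝ) (G : V → V →L[ℝ] V →L[ℝ] ℝ) (x v w : V) :
    conformalMetric ψ G x v w = Real.exp (2 * ψ x) * G x v w := rfl

theorem conformalSchouten_apply (G : V → V →L[ℝ] V →L[ℝ] ℝ) (ψ : V → ℝ) (x v : V) :
    conformalSchouten G ψ x v =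
      covariantDerivAlong G id (localGradient G ψ) x v - fderiv ℝ ψ x v • localGradient G ψ x
        + (1 / 2 * fderiv ℝ ψ x (localGradient G ψ x)) • v := by
  rw [covariantDerivAlong_id]
  rfl

theorem IsMetricAt.conformal (hG : IsMetricAt G x) (hψ : ContDiffAt ℝ 2 ψ x) :
    IsMetricAt (conformalMetric ψ G) x where
  contDiffAt := (contDiffAt_const.mul hψ).exp.smul hG.contDiffAt
  symm := hG.symm.mono fun y hy v w => by rw [conformalMetric_apply, conformalMetric_apply, hy]
  isInvertible := by
    obtain ⟨e, he⟩ := hG.isInvertible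
    refine ⟨e.trans (ContinuousLinearEquiv.smulLeft (Units.mk0 _ (Real.exp_ne_zero (2 * ψ x)))), ?_⟩
    rw [conformalMetric, ← he]
    rfl

namespace IsMetricAt

theorem apply_localGradient (hG : IsMetricAt G x) (v : V) :
    G x (localGradient G ψ x) v = fderiv ℝ ψ x v :=
  apply_sharp hG.isInvertible _ v

theorem christoffelFirst_conformal (hG : IsMetricAt G x) (hψ : DifferentiableAt ℝ ψ x)
    (v w z : V) : christoffelFirst (conformalMetric ψ G) x v w z =
      Real.exp (2 * ψ x) * (christoffelFirst G x v w z + fderiv ℝ ψ x v * G x w z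
        + fderiv ℝ ψ x w * G x v z - fderiv ℝ ψ x z * G x v w) := by
  have fderiv_conformal : fderiv ℝ (conformalMetric ψ G) x = _ :=
    ((hψ.hasFDerivAt.const_mul 2).exp.smul hG.differentiableAt.hasFDerivAt).fderiv
  simp only [christoffelFirst_apply, fderiv_conformal, add_apply, smul_apply,
    ContinuousLinearMap.smulRight_apply, smul_eq_mul]
  ring

theorem christoffel_conformal (hG : IsMetricAt G x) (hψ : ContDiffAt ℝ 2 ψ x) (v w : V) :
    christoffel (conformalMetric ψ G) x v w =
      christoffel G x v w + conformalDifference G ψ x v w := by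
  refine ext_of_form (hG.conformal hψ).isInvertible fun z => ?_
  rw [(hG.conformal hψ).apply_christoffel,
    hG.christoffelFirst_conformal (hψ.differentiableAt (by norm_num)), conformalMetric_apply,
    conformalDifference]
  simp only [map_add, map_sub, map_smul, add_apply, sub_apply, smul_apply, smul_eq_mul,
    hG.apply_localGradient, hG.apply_christoffel]
  ring

variable [CompleteSpace V]

theorem differentiableAt_localGradient (hG : IsMetricAt G x) (hψ : ContDiffAt ℝ 2 ψ x) :
    DifferentiableAt ℝ (localGradient G ψ) x :=
  ((hG.isInvertible.contDiffAt_map_inverse.comp x hG.contDiffAt).differentiableAt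
    (by norm_num)).clm_apply (hasFDerivAt_fderiv hψ).differentiableAt

theorem apply_covariantDerivAlong_localGradient (hG : IsMetricAt G x) (hψ : ContDiffAt ℝ 2 ψ x)
    (u v : V) :
    G x (covariantDerivAlong G id (localGradient G ψ) x u) v =
      fderiv ℝ (fderiv ℝ ψ) x u v - fderiv ℝ ψ x (christoffel G x u v) := by
  have gradient_eq : (fun y => G y (localGradient G ψ y) v) =ᶠ[𝓝 x] fun y => fderiv ℝ ψ y v :=
    hG.eventually.mono fun y hy => hy.apply_localGradient v
  have product_rule := hG.fderiv_apply_vectorFields (hG.differentiableAt_localGradient hψ)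
    (differentiableAt_const v) u
  rw [gradient_eq.fderiv_eq, covariantDerivAlong_id _ (fun _ => v), fderiv_fun_const,
    Pi.zero_apply, zero_apply, zero_add, hG.apply_localGradient,
    ((hasFDerivAt_fderiv hψ).clm_apply (hasFDerivAt_const v x)).fderiv] at product_rule
  simp only [add_apply, ContinuousLinearMap.comp_apply, zero_apply, map_zero, zero_add,
    ContinuousLinearMap.flip_apply] at product_rule
  linarith

theorem apply_conformalSchouten (hG : IsMetricAt G x) (hψ : ContDiffAt ℝ 2 ψ x) (v w : V) :
    G x (conformalSchouten G ψ x v) w =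
      fderiv ℝ (fderiv ℝ ψ) x v w - fderiv ℝ ψ x (christoffel G x v w)
        - fderiv ℝ ψ x v * fderiv ℝ ψ x w
        + 1 / 2 * fderiv ℝ ψ x (localGradient G ψ x) * G x v w := by
  simp only [conformalSchouten_apply, map_add, map_sub, map_smul, add_apply, sub_apply, smul_apply,
    smul_eq_mul, hG.apply_localGradient, hG.apply_covariantDerivAlong_localGradient hψ]

theorem conformalSchouten_symm (hG : IsMetricAt G x) (hψ : ContDiffAt ℝ 2 ψ x) (v w : V) :
    G x (conformalSchouten G ψ x v) w = G x v (conformalSchouten G ψ x w) := by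
  rw [hG.isScalarProduct.symm v, hG.apply_conformalSchouten hψ, hG.apply_conformalSchouten hψ,
    hG.christoffel_symm v w, hG.isScalarProduct.symm v w,
    (hψ.isSymmSndFDerivAt (by simp)).eq v w]
  ring

theorem hasFDerivAt_conformalDifference (hG : IsMetricAt G x) (hψ : ContDiffAt ℝ 2 ψ x) (v w : V) :
    HasFDerivAt (fun y => conformalDifference G ψ y v w)
      (((fderiv ℝ (fderiv ℝ ψ) x).flip v).smulRight w
        + ((fderiv ℝ (fderiv ℝ ψ) x).flip w).smulRight v
        - (G x v w • fderiv ℝ (localGradient G ψ) x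
          + (((fderiv ℝ G x).flip v).flip w).smulRight (localGradient G ψ x))) x := by
  have fderiv_ψ (v : V) :
      HasFDerivAt (fun y => fderiv ℝ ψ y v) ((fderiv ℝ (fderiv ℝ ψ) x).flip v) x := by
    simpa using (hasFDerivAt_fderiv hψ).clm_apply (hasFDerivAt_const v x)
  have fderiv_G : HasFDerivAt (fun y => G y v w) (((fderiv ℝ G x).flip v).flip w) x := by
    simpa using (hG.differentiableAt.hasFDerivAt.clm_apply (hasFDerivAt_const v x)).clm_apply
      (hasFDerivAt_const w x)
  exact (((fderiv_ψ v).smul_const w).add ((fderiv_ψ w).smul_const v)).sub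
    (fderiv_G.smul (hG.differentiableAt_localGradient hψ).hasFDerivAt)

theorem covariantDerivAlong_conformalDifference (hG : IsMetricAt G x) (hψ : ContDiffAt ℝ 2 ψ x)
    (u v w : V) :
    covariantDerivAlong G id (fun y => conformalDifference G ψ y v w) x u =
      fderiv ℝ (fderiv ℝ ψ) x u v • w + fderiv ℝ ψ x v • christoffel G x u w
        + fderiv ℝ (fderiv ℝ ψ) x u w • v + fderiv ℝ ψ x w • christoffel G x u v
        - (G x (christoffel G x u v) w + G x v (christoffel G x u w)) • localGradient G ψ x
        - G x v w • covariantDerivAlong G id (localGradient G ψ) x u := by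
  rw [covariantDerivAlong_id, (hG.hasFDerivAt_conformalDifference hψ v w).fderiv,
    ← hG.fderiv_eq_christoffel, conformalDifference, covariantDerivAlong_id]
  simp only [map_add, map_sub, map_smul, add_apply, sub_apply, smul_apply,
    ContinuousLinearMap.smulRight_apply, ContinuousLinearMap.flip_apply]
  module

theorem secondCovariant_conformal (hG : IsMetricAt G x) (hψ : ContDiffAt ℝ 2 ψ x) (u v w : V) :
    secondCovariant (conformalMetric ψ G) x u v w =
      secondCovariant G x u v w
        + covariantDerivAlong G id (fun y => conformalDifference G ψ y v w) x u
        + conformalDifference G ψ x u (christoffel G x v w + conformalDifference G ψ x v w) := by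
  have christoffel_eq : (fun y => christoffel (conformalMetric ψ G) y v w) =ᶠ[𝓝 x]
      fun y => christoffel G y v w + conformalDifference G ψ y v w := by
    filter_upwards [hG.eventually, hψ.eventually (by simp)] with y hGy hψy
    exact hGy.christoffel_conformal hψy v w
  have differentiable_christoffel : DifferentiableAt ℝ (fun y => christoffel G y v w) x :=
    (hG.differentiableAt_christoffel.clm_apply (differentiableAt_const v)).clm_apply
      (differentiableAt_const w)
  rw [← (hG.conformal hψ).covariantDerivAlong_christoffel, covariantDerivAlong_congr christoffel_eq,
    covariantDerivAlong_id, hG.christoffel_conformal hψ, ← add_assoc, ← covariantDerivAlong_id,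
    covariantDerivAlong_add differentiable_christoffel
      (hG.hasFDerivAt_conformalDifference hψ v w).differentiableAt,
    hG.covariantDerivAlong_christoffel]

theorem localCurvature_conformal (hG : IsMetricAt G x) (hψ : ContDiffAt ℝ 2 ψ x) :
    localCurvature (conformalMetric ψ G) x =
      localCurvature G x - kulkarniNomizu (G x) (conformalSchouten G ψ x) := by
  have hessian_symm := (hψ.isSymmSndFDerivAt (by simp)).eq
  ext u v w
  rw [sub_apply, sub_apply, sub_apply, localCurvature_apply, localCurvature_apply,
    hG.secondCovariant_conformal hψ, hG.secondCovariant_conformal hψ,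
    hG.covariantDerivAlong_conformalDifference hψ, hG.covariantDerivAlong_conformalDifference hψ,
    kulkarniNomizu_apply, hG.apply_conformalSchouten hψ, hG.apply_conformalSchouten hψ,
    conformalSchouten_apply, conformalSchouten_apply, hessian_symm v u, hG.christoffel_symm v u]
  simp only [conformalDifference, map_add, map_sub, map_smul, smul_eq_mul,
    hG.isScalarProduct.symm _ (localGradient G ψ x), hG.apply_localGradient,
    hG.isScalarProduct.symm v u]
  module

end IsMetricAt

end Conformal

section Charts

variable {n k : ℕ} {M : Type*} [TopologicalSpace M] [ChartedSpace (E n) M]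
  {N : Type*} [TopologicalSpace N] [ChartedSpace (E k) N]

theorem writtenInExtChartAt_self (f : M → N) (p : M) :
    writtenInExtChartAt (𝓡 n) (𝓡 k) p f (extChartAt (𝓡 n) p p) = extChartAt (𝓡 k) (f p) (f p) := by
  simp only [writtenInExtChartAt, Function.comp_apply, extChartAt_to_inv]

theorem pullback_at_apply (f : M → N) (g : FormField k N) (p : M) (v w : E n) :
    FormField.at (pullback f g) p v w = g.at (f p) (differential f p v) (differential f p w) :=
  rfl

section SmoothMap

variable {f : M → N} (hf : ContMDiff (𝓡 n) (𝓡 k) ∞ f) (p : M)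

include hf

theorem fderiv_writtenInExtChartAt :
    fderiv ℝ (writtenInExtChartAt (𝓡 n) (𝓡 k) p f) (extChartAt (𝓡 n) p p) = differential f p := by
  have mfderiv_eq := (hf.mdifferentiable (by simp) p).mfderiv
  rw [ModelWithCorners.Boundaryless.range_eq_univ, fderivWithin_univ] at mfderiv_eq
  exact mfderiv_eq.symm

theorem contDiffAt_writtenInExtChartAt :
    ContDiffAt ℝ ∞ (writtenInExtChartAt (𝓡 n) (𝓡 k) p f) (extChartAt (𝓡 n) p p) := by
  have contDiffWithinAt := (contMDiffAt_iff.mp (hf p)).2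
  rwa [ModelWithCorners.Boundaryless.range_eq_univ, contDiffWithinAt_univ] at contDiffWithinAt

end SmoothMap

variable [IsManifold (𝓡 n) ∞ M]

theorem contMDiffAt_extChartAt_symm (p : M) {x : E n} (hx : x ∈ (extChartAt (𝓡 n) p).target) :
    ContMDiffAt (𝓡 n) (𝓡 n) ∞ (extChartAt (𝓡 n) p).symm x :=
  (contMDiffOn_extChartAt_symm p).contMDiffAt ((isOpen_extChartAt_target p).mem_nhds hx)

theorem mdifferentiableAt_extChartAt_symm (p : M) {x : E n}
    (hx : x ∈ (extChartAt (𝓡 n) p).target) :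
    MDifferentiableAt (𝓡 n) (𝓡 n) (extChartAt (𝓡 n) p).symm x :=
  (contMDiffAt_extChartAt_symm p hx).mdifferentiableAt (by simp)

theorem differential_extChartAt_symm (p : M) :
    differential (extChartAt (𝓡 n) p).symm (extChartAt (𝓡 n) p p) =
      ContinuousLinearMap.id ℝ (E n) := by
  have : IsManifold (𝓡 n) 1 M := .of_le (n := ∞) (by simp)
  have mfderivWithin_eq := mfderivWithin_range_extChartAt_symm (I := 𝓡 n) (x := p)
  rwa [ModelWithCorners.Boundaryless.range_eq_univ, mfderivWithin_univ] at mfderivWithin_eq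

theorem inChart_self (g : FormField n M) (p : M) :
    inChart g p (extChartAt (𝓡 n) p p) = g.at p := by
  ext v w
  rw [inChart, pullback_at_apply, differential_extChartAt_symm, extChartAt_to_inv]
  rfl

/-- The trivialization of the tangent bundle at `p` maps coordinate vector fields to constants. -/
theorem contMDiffAt_coordinateVectorField (p : M) {x : E n}
    (hx : x ∈ (extChartAt (𝓡 n) p).target) (v : E n) :
    ContMDiffAt (𝓡 n) ((𝓡 n).prod (𝓘(ℝ, E n))) ∞
      (fun y => TotalSpace.mk' (E n) (E := fun q : M => TangentSpace (𝓡 n) q)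
        ((extChartAt (𝓡 n) p).symm y) (mfderiv (𝓡 n) (𝓡 n) (extChartAt (𝓡 n) p).symm y v)) x := by
  have : IsManifold (𝓡 n) 1 M := .of_le (n := ∞) (by simp)
  set φ := extChartAt (𝓡 n) p
  set e := trivializationAt (E n) (TangentSpace (𝓡 n)) p with he
  have mem_source {y : E n} (hy : y ∈ φ.target) : φ.symm y ∈ (chartAt (E n) p).source := by
    rw [← extChartAt_source (𝓡 n)]
    exact φ.map_target hy
  have mem_baseSet {y : E n} (hy : y ∈ φ.target) : φ.symm y ∈ e.baseSet := by
    rw [he, TangentBundle.trivializationAt_baseSet]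
    exact mem_source hy
  refine (e.contMDiffAt_iff (e.mem_source.mpr (mem_baseSet hx))).mpr
    ⟨contMDiffAt_extChartAt_symm p hx, (contMDiffAt_const (c := v)).congr_of_eventuallyEq ?_⟩
  filter_upwards [(isOpen_extChartAt_target p).mem_nhds hx] with y hy
  have trivialization_comp := mfderiv_extChartAt_comp_mfderivWithin_extChartAt_symm (I := 𝓡 n) hy
  rw [ModelWithCorners.Boundaryless.range_eq_univ, mfderivWithin_univ,
    ← TangentBundle.continuousLinearMapAt_trivializationAt (mem_source hy)] at trivialization_comp
  exact (congrFun (e.coe_linearMapAt_of_mem (R := ℝ) (mem_baseSet hy)) _).symm.trans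
    (congrArg (fun L : E n →L[ℝ] E n => L v) trivialization_comp)

theorem contDiffOn_inChart
    (g : ContMDiffRiemannianMetric (𝓡 n) ∞ (E n) (fun q : M => TangentSpace (𝓡 n) q)) (p : M) :
    ContDiffOn ℝ ∞ (inChart g.inner p) (extChartAt (𝓡 n) p).target := by
  have : IsManifold (𝓡 n) 1 M := .of_le (n := ∞) (by simp)
  refine contDiffOn_clm_apply.mpr fun v => contDiffOn_clm_apply.mpr fun w => ?_
  rw [← contMDiffOn_iff_contDiffOn]
  intro x hx
  set φ := extChartAt (𝓡 n) p
  have contMDiffAt_section : ContMDiffAt (𝓡 n) ((𝓡 n).prod 𝓘(ℝ)) ∞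
      (fun y => TotalSpace.mk' ℝ (E := Bundle.Trivial M ℝ) (φ.symm y)
        (g.inner (φ.symm y) (mfderiv (𝓡 n) (𝓡 n) φ.symm y v)
          (mfderiv (𝓡 n) (𝓡 n) φ.symm y w))) x := by
    apply ContMDiffAt.clm_bundle_apply₂ (F₁ := E n) (F₂ := E n)
    · exact g.contMDiff.contMDiffAt.comp x (contMDiffAt_extChartAt_symm p hx)
    · exact contMDiffAt_coordinateVectorField p hx v
    · exact contMDiffAt_coordinateVectorField p hx w
  rw [contMDiffAt_totalSpace] at contMDiffAt_section
  exact contMDiffAt_section.2.contMDiffWithinAt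

theorem isMetricAt_inChart
    (g : ContMDiffRiemannianMetric (𝓡 n) ∞ (E n) (fun q : M => TangentSpace (𝓡 n) q)) (p : M) :
    IsMetricAt (inChart g.inner p) (extChartAt (𝓡 n) p p) where
  contDiffAt := ((contDiffOn_inChart g p).contDiffAt (extChartAt_target_mem_nhds p)).of_le
    ENat.LEInfty.out
  symm := .of_forall fun _ _ _ => g.symm _ _ _
  isInvertible := by
    rw [inChart_self]
    exact isInvertible_of_pos fun v hv => g.pos p v hv

theorem differential_extChartAt_symm_comp_fderiv [IsManifold (𝓡 k) ∞ N] {f : M → N}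
    (hf : ContMDiff (𝓡 n) (𝓡 k) ∞ f) (p : M) {x : E n} (hx : x ∈ (extChartAt (𝓡 n) p).target)
    (hfx : ∀ᶠ y in 𝓝 x, f ((extChartAt (𝓡 n) p).symm y) ∈ (extChartAt (𝓡 k) (f p)).source)
    (hdiff : DifferentiableAt ℝ (writtenInExtChartAt (𝓡 n) (𝓡 k) p f) x) :
    (differential (extChartAt (𝓡 k) (f p)).symm (writtenInExtChartAt (𝓡 n) (𝓡 k) p f x)).comp
        (fderiv ℝ (writtenInExtChartAt (𝓡 n) (𝓡 k) p f) x) =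
      (differential (k := k) f ((extChartAt (𝓡 n) p).symm x)).comp
        (differential (k := n) (extChartAt (𝓡 n) p).symm x) := by
  set φ := extChartAt (𝓡 n) p
  set ψ := extChartAt (𝓡 k) (f p)
  set F := writtenInExtChartAt (𝓡 n) (𝓡 k) p f
  have F_mem_target : F x ∈ ψ.target := ψ.map_source hfx.self_of_nhds
  have comp_eq : ψ.symm ∘ F =ᶠ[𝓝 x] f ∘ φ.symm := hfx.mono fun y hy => ψ.left_inv hy
  have mfderiv_eq : mfderiv (𝓡 n) (𝓡 k) (ψ.symm ∘ F) x = mfderiv (𝓡 n) (𝓡 k) (f ∘ φ.symm) x :=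
    comp_eq.mfderiv_eq
  rw [mfderiv_comp x (mdifferentiableAt_extChartAt_symm (f p) F_mem_target)
      hdiff.mdifferentiableAt,
    mfderiv_comp x (hf.mdifferentiable (by simp) _) (mdifferentiableAt_extChartAt_symm p hx),
    mfderiv_eq_fderiv] at mfderiv_eq
  exact mfderiv_eq

theorem inChart_pullback [IsManifold (𝓡 k) ∞ N] {f : M → N} (hf : ContMDiff (𝓡 n) (𝓡 k) ∞ f)
    (g : FormField k N) (p : M) :
    inChart (pullback f g) p =ᶠ[𝓝 (extChartAt (𝓡 n) p p)]
      localPullback (writtenInExtChartAt (𝓡 n) (𝓡 k) p f) (inChart g (f p)) := by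
  set φ := extChartAt (𝓡 n) p
  set ψ := extChartAt (𝓡 k) (f p)
  set F := writtenInExtChartAt (𝓡 n) (𝓡 k) p f
  have mem_source : ∀ᶠ x in 𝓝 (φ p), f (φ.symm x) ∈ ψ.source := by
    refine ContinuousAt.eventually_mem (f := f ∘ φ.symm)
      (hf.continuous.continuousAt.comp (continuousAt_extChartAt_symm p)) ?_
    rw [Function.comp_apply, extChartAt_to_inv]
    exact extChartAt_source_mem_nhds (f p)
  have differentiableAt_F : ∀ᶠ x in 𝓝 (φ p), DifferentiableAt ℝ F x :=
    (((contDiffAt_writtenInExtChartAt hf p).of_le ENat.LEInfty.out).eventually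
      (n := 1) (by simp)).mono fun _ hx => hx.differentiableAt (by norm_num)
  filter_upwards [extChartAt_target_mem_nhds p, mem_source.eventually_nhds,
    differentiableAt_F] with x hx hfx hdiff
  have chain_rule (v : E n) : differential ψ.symm (F x) (fderiv ℝ F x v) =
      differential f (φ.symm x) (differential φ.symm x v) :=
    congrArg (fun L : E n →L[ℝ] E k => L v)
      (differential_extChartAt_symm_comp_fderiv hf p hx hfx hdiff)
  have symm_F : ψ.symm (F x) = f (φ.symm x) := ψ.left_inv hfx.self_of_nhds
  ext v w
  rw [localPullback_apply, inChart, inChart, pullback_at_apply, pullback_at_apply,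
    pullback_at_apply, chain_rule, chain_rule, symm_F]

end Charts

section Congr

variable {V : Type*} [NormedAddCommGroup V] [NormedSpace ℝ V]
  {G G' : V → V →L[ℝ] V →L[ℝ] ℝ} {x : V}

theorem christoffel_congr (h : G =ᶠ[𝓝 x] G') : christoffel G =ᶠ[𝓝 x] christoffel G' := by
  filter_upwards [h, h.fderiv (𝕜 := ℝ)] with y eq_at fderiv_eq_at
  rw [christoffel, christoffel, christoffelFirst, christoffelFirst, eq_at, fderiv_eq_at]

theorem localCurvature_congr (h : G =ᶠ[𝓝 x] G') : localCurvature G x = localCurvature G' x := by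
  have christoffel_eq := christoffel_congr h
  rw [localCurvature, localCurvature, secondCovariant, secondCovariant, christoffel_eq.fderiv_eq,
    christoffel_eq.self_of_nhds]

end Congr

section RiemannianManifold

variable {n : ℕ} {M : Type*} [TopologicalSpace M] [ChartedSpace (E n) M] [IsManifold (𝓡 n) ∞ M]
  (g : ContMDiffRiemannianMetric (𝓡 n) ∞ (E n) (fun q : M => TangentSpace (𝓡 n) q)) (q : M)

theorem metric_pos {v : E n} (hv : v ≠ 0) : 0 < FormField.at g.inner q v v := g.pos q v hv

theorem isScalarProduct_metric : IsScalarProduct (FormField.at g.inner q) :=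
  ⟨g.symm q, isInvertible_of_pos fun _ => metric_pos g q⟩

theorem isCurvatureTensor_curvature :
    IsCurvatureTensor (FormField.at g.inner q) (curvature g.inner q) := by
  rw [← inChart_self]
  exact (isMetricAt_inChart g q).isCurvatureTensor

theorem IsConformallyFlat.exists_curvature_eq_kulkarniNomizu (h : IsConformallyFlat g.inner) :
    ∃ T : E n →L[ℝ] E n,
      (∀ v w, FormField.at g.inner q (T v) w = FormField.at g.inner q v (T w)) ∧
        curvature g.inner q = kulkarniNomizu (FormField.at g.inner q) T := by
  obtain ⟨U, hU, hq, φ, hφ, flat⟩ := h q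
  have smooth : ContDiffAt ℝ 2 (φ ∘ (extChartAt (𝓡 n) q).symm) (extChartAt (𝓡 n) q q) := by
    have contMDiffAt_φ : ContMDiffAt (𝓡 n) 𝓘(ℝ, ℝ) ∞ φ
        ((extChartAt (𝓡 n) q).symm (extChartAt (𝓡 n) q q)) := by
      rw [extChartAt_to_inv]
      exact hφ.contMDiffAt (hU.mem_nhds hq)
    exact (contMDiffAt_iff_contDiffAt.mp (contMDiffAt_φ.comp _
      (contMDiffAt_extChartAt_symm q (mem_extChartAt_target q)))).of_le ENat.LEInfty.out
  have metric := isMetricAt_inChart g q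
  have curvature_conformal := metric.localCurvature_conformal smooth
  refine ⟨conformalSchouten (inChart g.inner q) (φ ∘ (extChartAt (𝓡 n) q).symm)
    (extChartAt (𝓡 n) q q), ?_, ?_⟩ <;> rw [← inChart_self]
  · exact metric.conformalSchouten_symm smooth
  · exact sub_eq_zero.mp (curvature_conformal.symm.trans (flat q hq))

theorem HasConstantCurvature.curvature_eq_kulkarniNomizu {c : ℝ}
    (h : HasConstantCurvature g.inner c) :
    curvature g.inner q = kulkarniNomizu (FormField.at g.inner q)
      ((c / 2) • ContinuousLinearMap.id ℝ (E n)) := by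
  have hB := isScalarProduct_metric g q
  have hR := isCurvatureTensor_curvature g q
  have hKN : IsCurvatureTensor (FormField.at g.inner q) (kulkarniNomizu (FormField.at g.inner q)
      ((c / 2) • ContinuousLinearMap.id ℝ (E n))) :=
    isCurvatureTensor_kulkarniNomizu hB.symm fun v w => by simp
  refine hR.ext_of_planes hB.isInvertible hKN fun X Y => ?_
  by_cases hXY : LinearIndependent ℝ ![X, Y]
  · have gram_pos := sub_pos.mpr
      (sq_lt_mul_of_linearIndependent hB.symm (fun _ => metric_pos g q) hXY)
    refine ((div_eq_iff gram_pos.ne').mp (h q X Y hXY)).trans ?_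
    simp only [kulkarniNomizu_apply, smul_apply, ContinuousLinearMap.id_apply, map_add, map_sub,
      map_smul, add_apply, sub_apply, smul_eq_mul, hB.symm Y X]
    ring
  · rw [hR.apply_eq_zero_of_not_linearIndependent hXY,
      hKN.apply_eq_zero_of_not_linearIndependent hXY]

end RiemannianManifold

namespace IsSmoothImmersion

variable {m : ℕ} {N : Type*} [TopologicalSpace N] [ChartedSpace (E (m + 1)) N]
  [IsManifold (𝓡 (m + 1)) ∞ N] {M : Type*} [TopologicalSpace M] [ChartedSpace (E m) M]
  {f : M → N} (hf : IsSmoothImmersion m f)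
  (g : ContMDiffRiemannianMetric (𝓡 (m + 1)) ∞ (E (m + 1))
    (fun q : N => TangentSpace (𝓡 (m + 1)) q)) (p : M)

include hf

section Projection

theorem isScalarProduct_pullback :
    IsScalarProduct (FormField.at (n := m) (pullback f g.inner) p) where
  symm v w := by
    rw [pullback_at_apply, pullback_at_apply, (isScalarProduct_metric g (f p)).symm]
  isInvertible := isInvertible_of_pos fun v hv => by
    rw [pullback_at_apply]
    exact metric_pos g (f p) fun h => hv (hf.injective_mfderiv p (h.trans (map_zero _).symm))

theorem apply_tangentialProjection (W : E (m + 1)) (Y : E m) :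
    FormField.at (pullback f g.inner) p (tangentialProjection m f g.inner p W) Y =
      FormField.at g.inner (f p) W (differential f p Y) :=
  apply_sharp (hf.isScalarProduct_pullback g p).isInvertible _ Y

theorem tangentialProjection_differential (X : E m) :
    tangentialProjection m f g.inner p (differential f p X) = X :=
  ext_of_form (hf.isScalarProduct_pullback g p).isInvertible fun Y =>
    hf.apply_tangentialProjection g p (differential f p X) Y

theorem isCurvatureTensor_intermediateCurvature :
    IsCurvatureTensor (FormField.at (pullback f g.inner) p)
      (intermediateCurvature m f g.inner p) where
  antisymm X Y Z := by
    rw [intermediateCurvature_apply, (isCurvatureTensor_curvature g (f p)).antisymm, map_neg,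
      intermediateCurvature_apply]
  skew X Y Z W := by
    rw [intermediateCurvature_apply, intermediateCurvature_apply,
      hf.apply_tangentialProjection, hf.apply_tangentialProjection,
      (isCurvatureTensor_curvature g (f p)).skew]
  bianchi := by
    ext1 X
    ext1 Y
    ext1 Z
    simp only [cyclicSum_apply, intermediateCurvature_apply, ← map_add]
    rw [← cyclicSum_apply, (isCurvatureTensor_curvature g (f p)).bianchi]
    exact map_zero _

theorem intermediateCurvature_eq_kulkarniNomizu {T : E (m + 1) →L[ℝ] E (m + 1)}
    (h : curvature g.inner (f p) = kulkarniNomizu (FormField.at g.inner (f p)) T) :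
    intermediateCurvature m f g.inner p = kulkarniNomizu (FormField.at (pullback f g.inner) p)
      ((tangentialProjection m f g.inner p).comp (T.comp (differential f p))) := by
  ext1 X
  ext1 Y
  ext1 Z
  rw [intermediateCurvature_apply, h, kulkarniNomizu_apply, kulkarniNomizu_apply]
  simp only [ContinuousLinearMap.comp_apply, map_add, map_sub, map_smul,
    hf.tangentialProjection_differential, hf.apply_tangentialProjection, pullback_at_apply]

theorem tangentialProjection_comp_comp_differential_symm {T : E (m + 1) →L[ℝ] E (m + 1)}
    (hT : ∀ v w, FormField.at g.inner (f p) (T v) w = FormField.at g.inner (f p) v (T w))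
    (X Y : E m) :
    FormField.at (pullback f g.inner) p
        ((tangentialProjection m f g.inner p).comp (T.comp (differential f p)) X) Y =
      FormField.at (pullback f g.inner) p X
        ((tangentialProjection m f g.inner p).comp (T.comp (differential f p)) Y) := by
  rw [(hf.isScalarProduct_pullback g p).symm X]
  simp only [ContinuousLinearMap.comp_apply, hf.apply_tangentialProjection]
  rw [hT, (isScalarProduct_metric g (f p)).symm]

theorem apply_shapeOperator (ν : E (m + 1)) (X Y : E m) :
    FormField.at (pullback f g.inner) p (shapeOperator m f g.inner p ν X) Y =
      secondFundamentalForm m f g.inner p ν X Y :=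
  apply_endOfForm (hf.isScalarProduct_pullback g p).isInvertible _ X Y

end Projection

variable [IsManifold (𝓡 m) ∞ M]

theorem localPullback_inChart :
    localPullback (writtenInExtChartAt (𝓡 m) (𝓡 (m + 1)) p f) (inChart g.inner (f p))
      (extChartAt (𝓡 m) p p) = FormField.at (pullback f g.inner) p := by
  rw [← (inChart_pullback hf.contMDiff g.inner p).self_of_nhds, inChart_self]

theorem isNondegenerateImmersionAt :
    IsNondegenerateImmersionAt (writtenInExtChartAt (𝓡 m) (𝓡 (m + 1)) p f)
      (inChart g.inner (f p)) (extChartAt (𝓡 m) p p) where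
  contDiffAt := (contDiffAt_writtenInExtChartAt hf.contMDiff p).of_le ENat.LEInfty.out
  isMetricAt := by
    rw [writtenInExtChartAt_self]
    exact isMetricAt_inChart g (f p)
  isInvertible := by
    rw [hf.localPullback_inChart]
    exact (hf.isScalarProduct_pullback g p).isInvertible

theorem innerCurvature_eq :
    innerCurvature m f g.inner p =
      localCurvature (localPullback (writtenInExtChartAt (𝓡 m) (𝓡 (m + 1)) p f)
        (inChart g.inner (f p))) (extChartAt (𝓡 m) p p) :=
  localCurvature_congr (inChart_pullback hf.contMDiff g.inner p)

theorem isCurvatureTensor_innerCurvature :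
    IsCurvatureTensor (FormField.at (pullback f g.inner) p) (innerCurvature m f g.inner p) := by
  rw [hf.innerCurvature_eq, ← hf.localPullback_inChart]
  exact (hf.isNondegenerateImmersionAt g p).isMetricAt_localPullback.isCurvatureTensor

theorem hessian_eq_localHessian (X Y : E m) :
    hessian m f g.inner p X Y =
      localHessian (writtenInExtChartAt (𝓡 m) (𝓡 (m + 1)) p f) (inChart g.inner (f p))
        (extChartAt (𝓡 m) p p) X Y := by
  have christoffel_eq : christoffelAt (pullback f g.inner) p = _ :=
    (christoffel_congr (inChart_pullback hf.contMDiff g.inner p)).self_of_nhds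
  rw [hessian_apply, localHessian, christoffel_eq, fderiv_writtenInExtChartAt hf.contMDiff,
    writtenInExtChartAt_self, christoffelAt]

theorem hessian_symm (X Y : E m) : hessian m f g.inner p X Y = hessian m f g.inner p Y X := by
  rw [hf.hessian_eq_localHessian, hf.hessian_eq_localHessian,
    (hf.isNondegenerateImmersionAt g p).localHessian_symm]

theorem apply_hessian_differential (X Y Z : E m) :
    FormField.at g.inner (f p) (hessian m f g.inner p X Y) (differential f p Z) = 0 := by
  have orthogonal := (hf.isNondegenerateImmersionAt g p).apply_localHessian_fderiv X Y Z
  rwa [← hf.hessian_eq_localHessian, fderiv_writtenInExtChartAt hf.contMDiff,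
    writtenInExtChartAt_self, inChart_self] at orthogonal

theorem apply_innerCurvature (X Y Z W : E m) :
    FormField.at (pullback f g.inner) p (innerCurvature m f g.inner p X Y Z) W =
      FormField.at (pullback f g.inner) p (intermediateCurvature m f g.inner p X Y Z) W
        + FormField.at g.inner (f p) (hessian m f g.inner p Y Z) (hessian m f g.inner p X W)
        - FormField.at g.inner (f p) (hessian m f g.inner p X Z) (hessian m f g.inner p Y W) := by
  have gauss := (hf.isNondegenerateImmersionAt g p).gauss_equation X Y Z W
  simp only [← hf.hessian_eq_localHessian] at gauss
  rw [fderiv_writtenInExtChartAt hf.contMDiff, writtenInExtChartAt_self, inChart_self,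
    hf.localPullback_inChart, ← hf.innerCurvature_eq] at gauss
  rw [gauss, intermediateCurvature_apply, hf.apply_tangentialProjection, curvature]

theorem shapeOperator_symm (ν : E (m + 1)) (X Y : E m) :
    FormField.at (pullback f g.inner) p (shapeOperator m f g.inner p ν X) Y =
      FormField.at (pullback f g.inner) p X (shapeOperator m f g.inner p ν Y) := by
  rw [(hf.isScalarProduct_pullback g p).symm X, hf.apply_shapeOperator, hf.apply_shapeOperator,
    secondFundamentalForm_apply, secondFundamentalForm_apply, hf.hessian_symm]

section UnitNormal

variable {ν : E (m + 1)} (hν : IsUnitNormal m f g.inner p ν)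

include hν

theorem hessian_eq_secondFundamentalForm_smul (X Y : E m) :
    hessian m f g.inner p X Y = secondFundamentalForm m f g.inner p ν X Y • ν :=
  eq_smul_of_orthogonal_range (isScalarProduct_metric g (f p)) (hf.injective_mfderiv p)
    (by simp) hν.1 hν.2 (hf.apply_hessian_differential g p X Y)

theorem innerCurvature_eq_add_wedge :
    innerCurvature m f g.inner p = intermediateCurvature m f g.inner p
      + wedge (secondFundamentalForm m f g.inner p ν) (shapeOperator m f g.inner p ν) := by
  ext1 X
  ext1 Y
  ext1 Z
  refine ext_of_form (hf.isScalarProduct_pullback g p).isInvertible fun W => ?_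
  rw [hf.apply_innerCurvature]
  simp only [hf.hessian_eq_secondFundamentalForm_smul g p hν, add_apply, wedge_apply, map_add,
    map_sub, map_smul, sub_apply, smul_apply, smul_eq_mul, hf.apply_shapeOperator, hν.1]
  ring

theorem permeabilityForm_innerCurvature :
    permeabilityForm (innerCurvature m f g.inner p) (shapeOperator m f g.inner p ν) =
      permeabilityForm (intermediateCurvature m f g.inner p) (shapeOperator m f g.inner p ν) := by
  rw [hf.innerCurvature_eq_add_wedge g p hν, permeabilityForm_add,
    permeabilityForm_wedge_eq_zero, add_zero]
  intro Y Z
  rw [← hf.apply_shapeOperator, ← hf.apply_shapeOperator, (hf.isScalarProduct_pullback g p).symm]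

end UnitNormal

theorem isPermeable_iff :
    IsPermeable m f g.inner ↔ ∀ (p : M) (ν : E (m + 1)), IsUnitNormal m f g.inner p ν →
      permeabilityForm (intermediateCurvature m f g.inner p) (shapeOperator m f g.inner p ν) =
        0 :=
  forall₂_congr fun p _ => forall_congr' fun hν => by
    rw [← permeabilityForm_eq_zero_iff, hf.permeabilityForm_innerCurvature g p hν]

theorem permeabilityForm_eq_zero_of_isConformallyFlat {ν : E (m + 1)}
    (hconf : IsConformallyFlat g.inner)
    (h : Commute (intermediateRicci m f g.inner p) (shapeOperator m f g.inner p ν)) :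
    permeabilityForm (intermediateCurvature m f g.inner p) (shapeOperator m f g.inner p ν) =
      0 := by
  obtain ⟨T, hT, curvature_eq⟩ := hconf.exists_curvature_eq_kulkarniNomizu g (f p)
  rw [intermediateRicci, hf.intermediateCurvature_eq_kulkarniNomizu g p curvature_eq] at h
  rw [hf.intermediateCurvature_eq_kulkarniNomizu g p curvature_eq]
  exact permeabilityForm_kulkarniNomizu_eq_zero_of_commute_ricciEnd
    (hf.isScalarProduct_pullback g p) (hf.shapeOperator_symm g p ν)
    (hf.tangentialProjection_comp_comp_differential_symm g p hT) h

theorem isPermeable_of_hasConstantCurvature {c : ℝ} (hc : HasConstantCurvature g.inner c) :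
    IsPermeable m f g.inner := by
  refine (hf.isPermeable_iff g).mpr fun p ν _ => ?_
  have projection_eq : (tangentialProjection m f g.inner p).comp
      (((c / 2) • ContinuousLinearMap.id ℝ (E (m + 1))).comp (differential f p)) =
        (c / 2) • ContinuousLinearMap.id ℝ (E m) := by
    ext1 X
    simp only [ContinuousLinearMap.comp_apply, smul_apply, ContinuousLinearMap.id_apply, map_smul,
      hf.tangentialProjection_differential]
  rw [hf.intermediateCurvature_eq_kulkarniNomizu g p (hc.curvature_eq_kulkarniNomizu g (f p)),
    projection_eq]
  exact permeabilityForm_kulkarniNomizu_eq_zero (hf.isScalarProduct_pullback g p).symm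
    (hf.shapeOperator_symm g p ν)
    (fun v w => by simp only [smul_apply, ContinuousLinearMap.id_apply, map_smul])
    ((Commute.one_left _).smul_left _)

end IsSmoothImmersion

end Hypersurface

theorem mainTheorem6 (m : ℕ)
    {Mout : Type*} [TopologicalSpace Mout] [ChartedSpace (EuclideanSpace ℝ (Fin (m + 1))) Mout]
    [IsManifold (𝓡 (m + 1)) ∞ Mout]
    {M : Type*} [TopologicalSpace M] [ChartedSpace (EuclideanSpace ℝ (Fin m)) M]
    [IsManifold (𝓡 m) ∞ M]
    (g : ContMDiffRiemannianMetric (𝓡 (m + 1)) ∞ (EuclideanSpace ℝ (Fin (m + 1)))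
      (fun q : Mout => TangentSpace (𝓡 (m + 1)) q))
    (f : M → Mout) (hf : Hypersurface.IsSmoothImmersion m f) :
    (Hypersurface.IsPermeable m f g.inner →
      ∀ (p : M) (ν : EuclideanSpace ℝ (Fin (m + 1))), Hypersurface.IsUnitNormal m f g.inner p ν →
        Commute (Hypersurface.innerRicci m f g.inner p) (Hypersurface.shapeOperator m f g.inner p ν) ∧
        Commute (Hypersurface.intermediateRicci m f g.inner p)
          (Hypersurface.shapeOperator m f g.inner p ν)) ∧
    ((m = 3 ∨ Hypersurface.IsConformallyFlat g.inner) →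
      (∀ (p : M) (ν : EuclideanSpace ℝ (Fin (m + 1))), Hypersurface.IsUnitNormal m f g.inner p ν →
        Commute (Hypersurface.intermediateRicci m f g.inner p)
          (Hypersurface.shapeOperator m f g.inner p ν)) →
      Hypersurface.IsPermeable m f g.inner) ∧
    (∀ c : ℝ, Hypersurface.HasConstantCurvature g.inner c →
      Hypersurface.IsPermeable m f g.inner) := by
  open Hypersurface in
  refine ⟨fun h p ν hν => ?_, fun hout h => (hf.isPermeable_iff g).mpr fun p ν hν => ?_,
    fun c hc => hf.isPermeable_of_hasConstantCurvature g hc⟩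
  · have hB := hf.isScalarProduct_pullback g p
    have hA := hf.shapeOperator_symm g p ν
    exact ⟨commute_ricciEnd_of_permeabilityForm_eq_zero hB
        (hf.isCurvatureTensor_innerCurvature g p) hA (permeabilityForm_eq_zero_iff.mpr (h p ν hν)),
      commute_ricciEnd_of_permeabilityForm_eq_zero hB
        (hf.isCurvatureTensor_intermediateCurvature g p) hA ((hf.isPermeable_iff g).mp h p ν hν)⟩
  · rcases hout with rfl | hconf
    · exact permeabilityForm_eq_zero_of_commute_ricciEnd_of_finrank_eq_three
        (hf.isScalarProduct_pullback g p) (hf.isCurvatureTensor_intermediateCurvature g p)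
        (hf.shapeOperator_symm g p ν) finrank_euclideanSpace_fin (h p ν hν)
    · exact hf.permeabilityForm_eq_zero_of_isConformallyFlat g p hconf (h p ν hν)
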